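/- Let $G$ be a connected, simply connected, complex semisimple Lie group (equivalently, a connected, simply connected, complex semisimple linear algebraic group) with Lie algebra $\mathfrak g$, Killing form $\langle\cdot,\cdot\rangle$ and rank $\mathrm{rk}(G)$, the dimension of a Cartan subalgebra of $\mathfrak g$. Let $\mathfrak g_{\rm reg}\subseteq\mathfrak g$ be the set of regular elements, i.e. of those $z\in\mathfrak g$ whose centralizer $\{y\in\mathfrak g : [z,y]=0\}$ has dimension $\mathrm{rk}(G)$. Let $X$ be a non-empty complex manifold (Hausdorff, second countable, of pure dimension $\dim X$) with a holomorphic symplectic form $\omega$, and let $G$ act holomorphically on $X$. For $y\in\mathfrak g$ let $y_X(x)=\frac{d}{dt}\big|_{t=0}\exp(ty)\cdot x$ be the fundamental vector field. Assume that - the action is locally free: for all $x\in X$ the Lie algebra $\{y\in\mathfrak g : y_X(x)=0\}$ of the stabilizer of $x$ is zero; - the action is Hamiltonian with moment map $\mu:X\to\mathfrak g$ (where $\mathfrak g^*\cong\mathfrak g$ through the Killing form): $G$ preserves $\omega$, the map $\mu$ is holomorphic, $\mu(g\cdot x)=\mathrm{Ad}_g(\mu(x))$ for all $g\in G$, $x\in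 X$, and $d\langle\mu,y\rangle=\omega(y_X,\cdot)$ for all $y\in\mathfrak g$. Then the connected components of the fibres of $\mu$ are the leaves of a holomorphic foliation $\mathcal F_\mu$ of $X$ of dimension $\dim X-\dim G$. This foliation is isotropic (that is, $\omega$ vanishes on the tangent spaces of its leaves) if and only if $$\mu(X)\subseteq\mathfrak g_{\rm reg}\quad\text{and}\quad \dim X=\dim G+\mathrm{rk}(G).$$ In that case $(X,\mathcal F_\mu)$ is an abstract integrable system of rank $\mathrm{rk}(G)$: the foliation $\mathcal F_\mu$ has dimension $\mathrm{rk}(G)$, and every point of $X$ has an open neighbourhood $U$ together with finitely many holomorphic first integrals on $U$ (holomorphic functions on $U$ that are constant on the leaves of $\mathcal F_\mu|_U$) whose Hamiltonian vector fields span the tangent space of $\mathcal F_\mu$ at every point of $U$. -/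

import Mathlib

open scoped Manifold ContDiff Topology

noncomputable section

/-! Throughout, a complex manifold is a manifold of class `C^ω` over `ℂ`, modelled on a
finite-dimensional complex vector space. A complex Lie group `G` is modelled on `E`, the
manifold `X` is modelled on `F`. -/

section LieTheory

instance tangentSpaceFiniteDimensional {E : Type*} [NormedAddCommGroup E] [NormedSpace ℂ E]
    [FiniteDimensional ℂ E] {M : Type*} [TopologicalSpace M] [ChartedSpace E M] (x : M) :
    FiniteDimensional ℂ (TangentSpace 𝓘(ℂ, E) x) :=
  inferInstanceAs (FiniteDimensional ℂ E)

/-- The set of regular elements of a complex Lie algebra `L`: those `x` whose centralizer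
`{y | [x, y] = 0}` has dimension equal to the rank of `L`. Semisimplicity of `x` is not required. -/
def regularElements (L : Type*) [LieRing L] [LieAlgebra ℂ L] [FiniteDimensional ℂ L] : Set L :=
  {x | Module.finrank ℂ (LinearMap.ker (LieAlgebra.ad ℂ L x)) = LieAlgebra.rank ℂ L}

variable {E : Type*} [NormedAddCommGroup E] [NormedSpace ℂ E]
  {G : Type*} [TopologicalSpace G] [ChartedSpace E G] [Group G]

/-- The adjoint representation of `G`: `Ad g` is the differential at `1` of `h ↦ g * h * g⁻¹`.
The target `T_{g * 1 * g⁻¹} G` is literally the same vector space as `T_1 G`. -/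
def adjointAction (g : G) (y : GroupLieAlgebra 𝓘(ℂ, E) G) : GroupLieAlgebra 𝓘(ℂ, E) G :=
  mfderiv 𝓘(ℂ, E) 𝓘(ℂ, E) (fun h : G => g * h * g⁻¹) 1 y

end LieTheory

section Symplectic

variable (F : Type*) [NormedAddCommGroup F] [NormedSpace ℂ F]
  (X : Type*) [TopologicalSpace X] [ChartedSpace F X]

variable {F X} in
/-- The coordinate expression of a field of alternating 2-forms in the chart at `x₀`: its pullback
along the inverse of the chart. -/
def twoFormInChart (Ω : ∀ x : X, TangentSpace 𝓘(ℂ, F) x [⋀^Fin 2]→L[ℂ] ℂ) (x₀ : X) (z : F) :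
    F [⋀^Fin 2]→L[ℂ] ℂ :=
  (Ω ((chartAt F x₀).symm z)).compContinuousLinearMap
    (mfderiv 𝓘(ℂ, F) 𝓘(ℂ, F) (chartAt F x₀).symm z)

/-- A holomorphic symplectic form on a complex manifold `X`: a holomorphic, closed and
non-degenerate 2-form. -/
structure HolomorphicSymplecticForm where
  /-- The underlying field of alternating bilinear forms. -/
  form : ∀ x : X, TangentSpace 𝓘(ℂ, F) x [⋀^Fin 2]→L[ℂ] ℂ
  holomorphic : ∀ x₀ : X, ContDiffOn ℂ ω (twoFormInChart form x₀) (chartAt F x₀).target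
  closed : ∀ x₀ : X, ∀ z ∈ (chartAt F x₀).target, extDeriv (twoFormInChart form x₀) z = 0
  nondegenerate : ∀ (x : X) (v : TangentSpace 𝓘(ℂ, F) x), (∀ w, form x ![v, w] = 0) → v = 0

variable {F X}

/-- `v` is the value at `x` of the Hamiltonian vector field of `f`, i.e. `Ω(v, ·) = df` at `x`. -/
def HolomorphicSymplecticForm.IsHamiltonianVector (Ω : HolomorphicSymplecticForm F X)
    (f : X → ℂ) (x : X) (v : TangentSpace 𝓘(ℂ, F) x) : Prop :=
  ∀ w : TangentSpace 𝓘(ℂ, F) x, Ω.form x ![v, w] = mfderiv 𝓘(ℂ, F) 𝓘(ℂ, ℂ) f x w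

end Symplectic

section Actions

variable {E : Type*} [NormedAddCommGroup E] [NormedSpace ℂ E]
  {G : Type*} [TopologicalSpace G] [ChartedSpace E G] [Group G]
  {F : Type*} [NormedAddCommGroup F] [NormedSpace ℂ F]
  {X : Type*} [TopologicalSpace X] [ChartedSpace F X] [MulAction G X]

/-- The fundamental vector field of `y` in the Lie algebra of `G`, at the point `x`: the
image of `y` under the differential at `1` of the orbit map `g ↦ g • x`, that is, the
velocity at time `0` of `t ↦ exp(t y) • x`.
The target `T_{1 • x} X` is literally the same vector space as `T_x X`. -/
def fundamentalVectorField (y : GroupLieAlgebra 𝓘(ℂ, E) G) (x : X) : TangentSpace 𝓘(ℂ, F) x :=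
  mfderiv 𝓘(ℂ, E) 𝓘(ℂ, F) (fun g : G => g • x) 1 y

variable (E G F X) in
/-- The action of `G` on `X` is locally free: for every `x`, the Lie algebra of the stabilizer
of `x`, which consists of all `y` whose fundamental vector field vanishes at `x`, is zero. -/
def IsLocallyFreeAction : Prop :=
  ∀ (x : X) (y : GroupLieAlgebra 𝓘(ℂ, E) G),
    fundamentalVectorField (F := F) y x = 0 → y = 0

/-- The action of `G` on `(X, Ω)` is Hamiltonian with moment map `μ : X → Lie(G)`, where the dual
of `Lie(G)` is identified with `Lie(G)` through the Killing form. -/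
structure IsHamiltonianAction [FiniteDimensional ℂ E] [LieGroup 𝓘(ℂ, E) ω G]
    (Ω : HolomorphicSymplecticForm F X) (μ : X → GroupLieAlgebra 𝓘(ℂ, E) G) : Prop where
  /-- `G` acts by symplectomorphisms. -/
  symplectic : ∀ (g : G) (x : X) (v w : TangentSpace 𝓘(ℂ, F) x),
    Ω.form (g • x) ![mfderiv 𝓘(ℂ, F) 𝓘(ℂ, F) (fun x' : X => g • x') x v,
      mfderiv 𝓘(ℂ, F) 𝓘(ℂ, F) (fun x' : X => g • x') x w] = Ω.form x ![v, w]
  /-- `μ` is holomorphic; the Lie algebra of `G` is, as a vector space, the model space `E`. -/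
  holomorphic : ContMDiff (M' := E) 𝓘(ℂ, F) 𝓘(ℂ, E) ω μ
  equivariant : ∀ (g : G) (x : X), μ (g • x) = adjointAction g (μ x)
  /-- The fundamental vector field of `y` is the Hamiltonian vector field of `⟨μ, y⟩`. -/
  isHamiltonianVector : ∀ (y : GroupLieAlgebra 𝓘(ℂ, E) G) (x : X),
    Ω.IsHamiltonianVector (fun x' => killingForm ℂ (GroupLieAlgebra 𝓘(ℂ, E) G) (μ x') y) x
      (fundamentalVectorField y x)

end Actions

section Foliations

variable (F : Type*) [NormedAddCommGroup F] [NormedSpace ℂ F]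
  {X : Type*} [TopologicalSpace X] [ChartedSpace F X]

/-- The partition of `X` into the classes of `s` is a holomorphic foliation of dimension `r`: there
are an `r`-dimensional subspace `V` of the model space and a set `A` of charts covering `X`
(a foliated atlas) such that the plaques `{y | φ y - φ x ∈ V}` of every chart `φ ∈ A` are connected,
the plaques of any two charts agree locally, and the classes of `s` (the leaves) are obtained by
chaining plaques. -/
def IsHolomorphicFoliation (s : Setoid X) (r : ℕ) : Prop :=
  ∃ (V : Submodule ℂ F) (A : Set (OpenPartialHomeomorph X F)),
    Module.finrank ℂ V = r ∧
    A ⊆ IsManifold.maximalAtlas 𝓘(ℂ, F) ω X ∧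
    (∀ x, ∃ φ ∈ A, x ∈ φ.source) ∧
    (∀ φ ∈ A, ∀ x ∈ φ.source, IsPreconnected {y | y ∈ φ.source ∧ φ y - φ x ∈ V}) ∧
    (∀ φ ∈ A, ∀ ψ ∈ A, ∀ x ∈ φ.source ∩ ψ.source,
      ∀ᶠ y in 𝓝 x, (φ y - φ x ∈ V ↔ ψ y - ψ x ∈ V)) ∧
    (∀ x y, s x y ↔
      Relation.EqvGen (fun a b => ∃ φ ∈ A, a ∈ φ.source ∧ b ∈ φ.source ∧ φ b - φ a ∈ V) x y)

/-- The tangent space at `x` of the leaf through `x`: the span of the velocities at `x` of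
holomorphic curves contained in that leaf. -/
def leafTangentSpace (s : Setoid X) (x : X) : Submodule ℂ (TangentSpace 𝓘(ℂ, F) x) :=
  Submodule.span ℂ {v | ∃ γ : ℂ → X, γ 0 = x ∧ ContMDiffAt 𝓘(ℂ, ℂ) 𝓘(ℂ, F) ω γ 0 ∧
    (∀ᶠ t in 𝓝 (0 : ℂ), s x (γ t)) ∧ v = mfderiv 𝓘(ℂ, ℂ) 𝓘(ℂ, F) γ 0 (1 : ℂ)}

/-- `f` is a holomorphic first integral on the open set `U`: it is holomorphic on `U` and constant
on the leaves of the restricted foliation, i.e. on the connected components of the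
intersections of the leaves with `U`. -/
def IsFirstIntegralOn (s : Setoid X) (U : Set X) (f : X → ℂ) : Prop :=
  ContMDiffOn 𝓘(ℂ, F) 𝓘(ℂ, ℂ) ω f U ∧
    ∀ x ∈ U, ∀ y ∈ connectedComponentIn ({z | s x z} ∩ U) x, f y = f x

variable {F}

/-- `s` is an isotropic foliation: a holomorphic foliation on whose leaves `Ω` vanishes. -/
def IsIsotropicFoliation (Ω : HolomorphicSymplecticForm F X) (s : Setoid X) : Prop :=
  (∃ r, IsHolomorphicFoliation F s r) ∧
    ∀ x, ∀ v ∈ leafTangentSpace F s x, ∀ w ∈ leafTangentSpace F s x, Ω.form x ![v, w] = 0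

/-- `(X, s)` is an abstract integrable system of rank `r`: a foliation of dimension `r` such that
each point has an open neighbourhood `U` with holomorphic first integrals on `U` whose
Hamiltonian vector fields span the tangent spaces of the leaves at all points of `U`. -/
def IsAbstractIntegrableSystem (Ω : HolomorphicSymplecticForm F X) (s : Setoid X) (r : ℕ) : Prop :=
  IsHolomorphicFoliation F s r ∧
    ∀ x : X, ∃ U : Set X, IsOpen U ∧ x ∈ U ∧ ∃ (k : ℕ) (f : Fin k → X → ℂ),
      (∀ i, IsFirstIntegralOn F s U (f i)) ∧
      ∀ y ∈ U, Submodule.span ℂ {v | ∃ i, Ω.IsHamiltonianVector (f i) y v} = leafTangentSpace F s y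

/-- The partition of `X` into the connected components of the fibres of `μ`. -/
def fibreComponents {Y : Type*} (μ : X → Y) : Setoid X :=
  Setoid.ker fun x => connectedComponentIn (μ ⁻¹' {μ x}) x

end Foliations

end

open scoped Manifold ContDiff Topology

noncomputable section

section RegularElements

variable {L : Type*} [LieRing L] [LieAlgebra ℂ L] [FiniteDimensional ℂ L]

/-- In a Lie algebra with nondegenerate Killing form, the centralizer of an element whose Engel
subalgebra has minimal dimension is that Engel subalgebra. -/
theorem LieAlgebra.IsRegular.mem_regularElements [LieAlgebra.IsKilling ℂ L] {x : L}
    (hx : LieAlgebra.IsRegular ℂ x) : x ∈ regularElements L := by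
  have hrank := (LieAlgebra.isRegular_iff_finrank_engel_eq_rank ℂ x).1 hx
  have hcard : (Module.finrank ℂ L : Cardinal) ≤ Cardinal.mk ℂ :=
    Cardinal.natCast_le_aleph0.trans (Cardinal.infinite_iff.mp inferInstance)
  have hCartan : (LieSubalgebra.engel ℂ x).IsCartanSubalgebra := by
    refine ⟨?_, LieSubalgebra.normalizer_engel _ _⟩
    apply LieSubalgebra.isNilpotent_of_forall_le_engel
    intro y hy
    let Ex : {LieSubalgebra.engel ℂ z | z ∈ LieSubalgebra.engel ℂ x} :=
      ⟨LieSubalgebra.engel ℂ x, x, LieSubalgebra.self_mem_engel _ _, rfl⟩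
    suffices IsBot Ex from this ⟨LieSubalgebra.engel ℂ y, y, hy, rfl⟩
    apply LieAlgebra.engel_isBot_of_isMin hcard (LieSubalgebra.engel ℂ x) Ex le_rfl
    rintro ⟨_, z, hz, rfl⟩ hzx
    have h : Module.finrank ℂ (LieSubalgebra.engel ℂ x)
        ≤ Module.finrank ℂ (LieSubalgebra.engel ℂ z) := by
      rw [hrank]
      exact LieAlgebra.rank_le_finrank_engel ℂ z
    have h' : LieSubalgebra.engel ℂ z = LieSubalgebra.engel ℂ x :=
      LieSubalgebra.toSubmodule_injective (Submodule.eq_of_le_of_finrank_le hzx h)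
    exact h'.ge
  have hss := LieAlgebra.IsKilling.isSemisimple_ad_of_mem_isCartanSubalgebra
    (LieSubalgebra.self_mem_engel ℂ x)
  have hker := hss.isFinitelySemisimple.maxGenEigenspace_eq_eigenspace 0
  rw [Module.End.eigenspace_zero] at hker
  change Module.finrank ℂ (LinearMap.ker (LieAlgebra.ad ℂ L x)) = _
  rw [← hker, ← hrank]
  rfl

end RegularElements

/-- A polynomial function that is not identically zero has non-zeros in every non-empty open set. -/
theorem exists_eval_repr_ne_zero {L ι : Type*} [Fintype ι] [NormedAddCommGroup L] [NormedSpace ℂ L]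
    [FiniteDimensional ℂ L] (b : Module.Basis ι ℂ L) (p : MvPolynomial ι ℂ)
    (hp : ∃ x, MvPolynomial.eval (b.repr x) p ≠ 0) {U : Set L} (hU : IsOpen U) (hne : U.Nonempty) :
    ∃ x ∈ U, MvPolynomial.eval (b.repr x) p ≠ 0 := by
  by_contra! h
  obtain ⟨x₀, hx₀⟩ := hne
  obtain ⟨x₁, hx₁⟩ := hp
  have han : AnalyticOnNhd ℂ (fun x => MvPolynomial.eval (b.equivFun x) p) Set.univ :=
    AnalyticOnNhd.eval_linearMap b.equivFun.toLinearMap p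
  refine hx₁ (han.eqOn_zero_of_preconnected_of_eventuallyEq_zero isPreconnected_univ
    (Set.mem_univ x₀) ?_ (Set.mem_univ x₁))
  filter_upwards [hU.mem_nhds hx₀] with x hx using h x hx

section LieGroupBracket

variable {E : Type*} [NormedAddCommGroup E] [NormedSpace ℂ E]

/-- The infinitesimal form of `Ad' = ad` in coordinates: `m` is a multiplication with unit `e`
and `c` is the corresponding conjugation, near `(e, e)`. -/
theorem fderiv_conj_eq_lieBracket {m c : E × E → E} {e : E}
    (hm : ContDiffAt ℂ 2 m (e, e)) (hc : ContDiffAt ℂ 2 c (e, e))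
    (hcm : ∀ᶠ p in 𝓝 (e, e), m (c p, p.1) = m p)
    (hce : ∀ᶠ a in 𝓝 e, c (a, e) = e) (hec : ∀ᶠ b in 𝓝 e, c (e, b) = b)
    (hme : ∀ᶠ a in 𝓝 e, m (a, e) = a) (hem : ∀ᶠ b in 𝓝 e, m (e, b) = b) (y z : E) :
    HasFDerivAt (fun a => fderiv ℂ (fun b => c (a, b)) e z)
      (fderiv ℂ (fun a => fderiv ℂ (fun b => c (a, b)) e z) e) e ∧
    fderiv ℂ (fun a => fderiv ℂ (fun b => c (a, b)) e z) e y =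
      VectorField.lieBracket ℂ (fun a => fderiv ℂ (fun b => m (a, b)) e y)
        (fun a => fderiv ℂ (fun b => m (a, b)) e z) e := by
  have hpair : ContDiffAt ℂ 2 (fun a : E => (a, e)) e := contDiffAt_id.prodMk contDiffAt_const
  have hev : ∀ {P : E × E → Prop}, (∀ᶠ p in 𝓝 (e, e), P p) → ∀ᶠ a in 𝓝 e, P (a, e) :=
    fun h => hpair.continuousAt.eventually h
  have hslice : ∀ {f : E × E → E}, ContDiffAt ℂ 2 f (e, e) → ∀ᶠ a in 𝓝 e, ∀ v,
      HasFDerivAt f (fderiv ℂ f (a, e)) (a, e) ∧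
      fderiv ℂ (fun b => f (a, b)) e v = fderiv ℂ f (a, e) (0, v) := by
    intro f hf
    have h1 : ∀ᶠ p in 𝓝 (e, e), ContDiffAt ℂ 2 f p := hf.eventually (by simp)
    filter_upwards [hev h1] with a ha v
    have hd : HasFDerivAt f (fderiv ℂ f (a, e)) (a, e) :=
      (ha.differentiableAt (by simp)).hasFDerivAt
    refine ⟨hd, ?_⟩
    have h2 : HasFDerivAt (fun b : E => (a, b)) (ContinuousLinearMap.inr ℂ E E) e :=
      hasFDerivAt_prodMk_right a e
    have h3 : HasFDerivAt (fun b : E => f (a, b))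
        ((fderiv ℂ f (a, e)).comp (ContinuousLinearMap.inr ℂ E E)) e := hd.comp e h2
    rw [h3.fderiv]
    simp
  have hsecond : ∀ {f : E × E → E}, ContDiffAt ℂ 2 f (e, e) → ∀ u : E × E,
      HasFDerivAt (fun a => fderiv ℂ f (a, e) u)
        (((fderiv ℂ (fderiv ℂ f) (e, e)).flip u).comp (ContinuousLinearMap.inl ℂ E E)) e := by
    intro f hf u
    have h1 : DifferentiableAt ℂ (fderiv ℂ f) (e, e) :=
      (hf.fderiv_right (m := 1) (by norm_num)).differentiableAt (by simp)
    have h2 : HasFDerivAt (fun a : E => (a, e)) (ContinuousLinearMap.inl ℂ E E) e :=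
      hasFDerivAt_prodMk_left e e
    have h3 := (h1.hasFDerivAt.comp (f := fun a : E => (a, e)) e h2).clm_apply (hasFDerivAt_const u e)
    convert! h3 using 1
    ext v
    simp
  have hR : ∀ v, HasFDerivAt (fun a => fderiv ℂ (fun b => m (a, b)) e v)
      (((fderiv ℂ (fderiv ℂ m) (e, e)).flip (0, v)).comp (ContinuousLinearMap.inl ℂ E E)) e :=
    fun v => (hsecond hm (0, v)).congr_of_eventuallyEq ((hslice hm).mono fun a ha => (ha v).2)
  have hA := (hsecond hc (0, z)).congr_of_eventuallyEq ((hslice hc).mono fun a ha => (ha z).2)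
  refine ⟨hA.differentiableAt.hasFDerivAt, ?_⟩
  have hRe : ∀ v, fderiv ℂ (fun b => m (e, b)) e v = v := by
    intro v
    rw [Filter.EventuallyEq.fderiv_eq (f := id) hem]
    simp
  have hAe : fderiv ℂ (fun b => c (e, b)) e z = z := by
    rw [Filter.EventuallyEq.fderiv_eq (f := id) hec]
    simp
  have hkey : (fun a => fderiv ℂ m (e, a) (fderiv ℂ (fun b => c (a, b)) e z, 0)) =ᶠ[𝓝 e]
      fun a => fderiv ℂ (fun b => m (a, b)) e z := by
    have hsw : ContinuousAt (fun a : E => (e, a)) e := by fun_prop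
    have hmd : ∀ᶠ p in 𝓝 (e, e), ContDiffAt ℂ 2 m p := hm.eventually (by simp)
    filter_upwards [hslice hm, hslice hc, hce, hev (eventually_eventually_nhds.2 hcm),
      hsw.eventually hmd] with a h1 h2 h3 h4 h5
    have hb : HasFDerivAt (fun b : E => (a, b)) (ContinuousLinearMap.inr ℂ E E) e :=
      hasFDerivAt_prodMk_right a e
    have hcb := (h2 z).1.comp e hb
    have hpc := hcb.prodMk (hasFDerivAt_const a e)
    have hmd' : HasFDerivAt m (fderiv ℂ m (e, a)) (c (a, e), a) := by
      rw [h3]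
      exact (h5.differentiableAt (by simp)).hasFDerivAt
    have hcomp := hmd'.comp e hpc
    have heq : (fun b => m (a, b)) =ᶠ[𝓝 e] m ∘ fun b => (c (a, b), a) := by
      have : ContinuousAt (fun b : E => (a, b)) e := by fun_prop
      filter_upwards [this.eventually h4] with b hb using hb.symm
    rw [heq.fderiv_eq]
    have hcomp' := hcomp.fderiv
    simp only [Function.comp_def] at hcomp' ⊢
    rw [hcomp', (h2 z).2]
    simp
  have hswap : HasFDerivAt (fun a => fderiv ℂ m (e, a))
      ((fderiv ℂ (fderiv ℂ m) (e, e)).comp (ContinuousLinearMap.inr ℂ E E)) e := by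
    have h1 : DifferentiableAt ℂ (fderiv ℂ m) (e, e) :=
      (hm.fderiv_right (m := 1) (by norm_num)).differentiableAt (by simp)
    exact h1.hasFDerivAt.comp e (hasFDerivAt_prodMk_right e e)
  have hL := hswap.clm_apply (hA.prodMk (hasFDerivAt_const (0 : E) e))
  have h1 := DFunLike.congr_fun ((hL.congr_of_eventuallyEq hkey.symm).unique (hR z)) y
  have hleft : ∀ u, fderiv ℂ m (e, e) (u, 0) = u := by
    intro u
    have h2 : HasFDerivAt (fun a : E => (a, e)) (ContinuousLinearMap.inl ℂ E E) e :=
      hasFDerivAt_prodMk_left e e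
    have h3 := ((hm.differentiableAt (by simp)).hasFDerivAt.comp (f := fun a : E => (a, e)) e h2).congr_of_eventuallyEq
      (f₁ := id) (hme.mono fun a ha => ha.symm)
    have := DFunLike.congr_fun (h3.unique (hasFDerivAt_id e)) u
    simpa using this
  have hsymm := (hm.isSymmSndFDerivAt (by simp)).eq (0, y) (z, 0)
  rw [VectorField.lieBracket, hRe, hRe, (hR z).fderiv, (hR y).fderiv, hA.fderiv]
  simp [hAe, hleft] at h1 hsymm ⊢
  rw [← h1, ← hsymm]
  abel

end LieGroupBracket

section Charts

variable {F E : Type*} [NormedAddCommGroup F] [NormedSpace ℂ F] [NormedAddCommGroup E]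
  [NormedSpace ℂ E] {M N : Type*} [TopologicalSpace M] [ChartedSpace F M] [TopologicalSpace N]
  [ChartedSpace E N]

theorem mfderiv_eq_fderiv_chart {f : M → N} {x : M}
    (hf : MDifferentiableAt 𝓘(ℂ, F) 𝓘(ℂ, E) f x) :
    mfderiv 𝓘(ℂ, F) 𝓘(ℂ, E) f x =
      (fderiv ℂ (fun z => chartAt E (f x) (f ((chartAt F x).symm z))) (chartAt F x x) :
        F →L[ℂ] E) := by
  refine hf.mfderiv.trans ?_
  change fderivWithin ℂ (fun z => chartAt E (f x) (f ((chartAt F x).symm z))) (Set.range id) _ = _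
  rw [Set.range_id, fderivWithin_univ]
  rfl

end Charts

section InverseFunction

variable {F : Type*} [NormedAddCommGroup F] [NormedSpace ℂ F]

/-- The analytic inverse function theorem, on a domain on which both the map and its inverse are
analytic. -/
theorem exists_openPartialHomeomorph_of_injective_fderiv [FiniteDimensional ℂ F] {f : F → F} {a : F}
    (hf : ContDiffAt ℂ ω f a) (hinj : Function.Injective (fderiv ℂ f a)) :
    ∃ e : OpenPartialHomeomorph F F, a ∈ e.source ∧ (e : F → F) = f ∧
      ContDiffOn ℂ ω e e.source ∧ ContDiffOn ℂ ω e.symm e.target := by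
  have : CompleteSpace F := FiniteDimensional.complete ℂ F
  let f' : F ≃L[ℂ] F :=
    (LinearEquiv.ofInjectiveEndo (fderiv ℂ f a).toLinearMap hinj).toContinuousLinearEquiv
  have hf' : HasFDerivAt f (f' : F →L[ℂ] F) a := by
    have h : (f' : F →L[ℂ] F) = fderiv ℂ f a := by
      ext v
      rfl
    rw [h]
    exact (hf.differentiableAt (by simp)).hasFDerivAt
  let e₀ := hf.toOpenPartialHomeomorph f hf' (by simp)
  have ha : a ∈ e₀.source := hf.mem_toOpenPartialHomeomorph_source hf' (by simp)
  have hinv : ContDiffAt ℂ ω e₀.symm (f a) := hf.to_localInverse hf' (by simp)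
  have h₁ : ∀ᶠ z in 𝓝 a, ContDiffAt ℂ ω f z := hf.eventually (by simp)
  have h₂ : ∀ᶠ z in 𝓝 a, ContDiffAt ℂ ω e₀.symm (f z) :=
    hf.continuousAt.eventually (hinv.eventually (by simp))
  obtain ⟨s, hs, hso, has⟩ := eventually_nhds_iff.1 (h₁.and h₂)
  have hsrc : (e₀.restrOpen s hso).source = e₀.source ∩ s := e₀.restrOpen_source s hso
  refine ⟨e₀.restrOpen s hso, by rw [hsrc]; exact ⟨ha, has⟩, rfl, ?_, ?_⟩
  · intro z hz
    rw [hsrc] at hz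
    exact (hs z hz.2).1.contDiffWithinAt
  · intro w hw
    have hz := (e₀.restrOpen s hso).map_target hw
    rw [hsrc] at hz
    have h := (hs _ hz.2).2
    have hw' : f ((e₀.restrOpen s hso).symm w) = w := (e₀.restrOpen s hso).right_inv hw
    rw [hw'] at h
    exact h.contDiffWithinAt

variable {M : Type*} [TopologicalSpace M] [ChartedSpace F M] [IsManifold 𝓘(ℂ, F) ω M]

theorem trans_mem_maximalAtlas_of_contDiffOn {χ : OpenPartialHomeomorph M F}
    (hχ : χ ∈ IsManifold.maximalAtlas 𝓘(ℂ, F) ω M) {e : OpenPartialHomeomorph F F}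
    (he : ContDiffOn ℂ ω e e.source) (he' : ContDiffOn ℂ ω e.symm e.target) :
    χ.trans e ∈ IsManifold.maximalAtlas 𝓘(ℂ, F) ω M := by
  rw [IsManifold.mem_maximalAtlas_iff_contMDiffOn] at hχ ⊢
  constructor
  · exact he.contMDiffOn.comp (hχ.1.mono fun x hx => by simp_all) fun x hx => by simp_all
  · exact hχ.2.comp (he'.contMDiffOn.mono fun x hx => by simp_all) fun x hx => by simp_all

theorem symm_restrOpen_symm_mem_maximalAtlas {φ : OpenPartialHomeomorph M F}
    (hφ : φ ∈ IsManifold.maximalAtlas 𝓘(ℂ, F) ω M) {s : Set F} (hs : IsOpen s) :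
    (φ.symm.restrOpen s hs).symm ∈ IsManifold.maximalAtlas 𝓘(ℂ, F) ω M := by
  rw [IsManifold.mem_maximalAtlas_iff_contMDiffOn] at hφ ⊢
  constructor
  · exact hφ.1.mono fun x hx => by simp_all
  · exact hφ.2.mono fun x hx => by simp_all

/-- Every submersion is, in suitable charts with convex target, a fixed linear projection. -/
theorem exists_chart_comp_eq [FiniteDimensional ℂ F] {E : Type*} [NormedAddCommGroup E] [NormedSpace ℂ E]
    [FiniteDimensional ℂ E] {f : M → E} (hf : ContMDiff 𝓘(ℂ, F) 𝓘(ℂ, E) ω f) (x : M)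
    (hsurj : Function.Surjective (mfderiv 𝓘(ℂ, F) 𝓘(ℂ, E) f x)) (π : F →L[ℂ] E)
    (hπ : Function.Surjective π) :
    ∃ φ ∈ IsManifold.maximalAtlas 𝓘(ℂ, F) ω M, x ∈ φ.source ∧ Convex ℝ φ.target ∧
      ∀ y ∈ φ.source, π (φ y) = f y := by
  let χ := chartAt F x
  have hχ : χ ∈ IsManifold.maximalAtlas 𝓘(ℂ, F) ω M := IsManifold.chart_mem_maximalAtlas x
  have hx : x ∈ χ.source := mem_chart_source F x
  let D : F →L[ℂ] E := fderiv ℂ (f ∘ χ.symm) (χ x)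
  have hD : mfderiv 𝓘(ℂ, F) 𝓘(ℂ, E) f x = D := by
    exact mfderiv_eq_fderiv_chart (hf.mdifferentiableAt (by simp))
  have hDsurj : Function.Surjective D := by
    intro v
    obtain ⟨w, hw⟩ := hsurj v
    rw [hD] at hw
    exact ⟨w, hw⟩
  have hg : ContDiffAt ℂ ω (f ∘ χ.symm) (χ x) := by
    rw [← contMDiffAt_iff_contDiffAt]
    exact hf.contMDiffAt.comp _ (contMDiffAt_symm_of_mem_maximalAtlas hχ (χ.map_source hx))
  obtain ⟨σ, hσ⟩ := π.toLinearMap.exists_rightInverse_of_surjective (LinearMap.range_eq_top.2 hπ)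
  obtain ⟨p, hp⟩ := (LinearMap.ker D.toLinearMap).subtype.exists_leftInverse_of_injective
    (by simp)
  have hrank : Module.finrank ℂ (LinearMap.ker D.toLinearMap) =
      Module.finrank ℂ (LinearMap.ker π.toLinearMap) := by
    have h₁ := D.toLinearMap.finrank_range_add_finrank_ker
    have h₂ := π.toLinearMap.finrank_range_add_finrank_ker
    rw [LinearMap.range_eq_top.2 hDsurj] at h₁
    rw [LinearMap.range_eq_top.2 hπ] at h₂
    omega
  let i := LinearEquiv.ofFinrankEq _ _ hrank
  let L : F →L[ℂ] F := LinearMap.toContinuousLinearMap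
    ((LinearMap.ker π.toLinearMap).subtype ∘ₗ i.toLinearMap ∘ₗ p)
  let σ' : E →L[ℂ] F := LinearMap.toContinuousLinearMap σ
  have hπσ : ∀ v, π (σ' v) = v := fun v => LinearMap.congr_fun hσ v
  have hπL : ∀ v, π (L v) = 0 := fun v => (i (p v)).2
  let Ψ : F → F := fun z => σ' ((f ∘ χ.symm) z) + L z
  have hΨ : ContDiffAt ℂ ω Ψ (χ x) :=
    (σ'.contDiff.contDiffAt.comp _ hg).add L.contDiff.contDiffAt
  have hΨ' : HasFDerivAt Ψ (σ'.comp D + L) (χ x) :=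
    (σ'.hasFDerivAt.comp _ (hg.differentiableAt (by simp)).hasFDerivAt).add L.hasFDerivAt
  have hinj : Function.Injective (fderiv ℂ Ψ (χ x)) := by
    rw [hΨ'.fderiv]
    refine (injective_iff_map_eq_zero _).2 fun v hv => ?_
    have hv' : σ' (D v) + L v = 0 := hv
    have hDv : D v = 0 := by
      have := congrArg π hv'
      simpa [hπσ, hπL] using this
    rw [hDv, map_zero, zero_add] at hv'
    have hpv : i (p v) = 0 := Subtype.ext hv'
    have h := LinearMap.congr_fun hp ⟨v, hDv⟩
    simp only [LinearMap.comp_apply, Submodule.subtype_apply, LinearMap.id_apply] at h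
    rw [h, LinearEquiv.map_eq_zero_iff] at hpv
    exact congrArg Subtype.val hpv
  obtain ⟨e, hes, heΨ, he, he'⟩ := exists_openPartialHomeomorph_of_injective_fderiv hΨ hinj
  have hφ := trans_mem_maximalAtlas_of_contDiffOn hχ he he'
  have hxs : x ∈ (χ.trans e).source := by
    rw [OpenPartialHomeomorph.trans_source]
    exact ⟨hx, hes⟩
  obtain ⟨ε, hε, hball⟩ := Metric.isOpen_iff.1 (χ.trans e).open_target _ ((χ.trans e).map_source hxs)
  refine ⟨_, symm_restrOpen_symm_mem_maximalAtlas hφ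
    (Metric.isOpen_ball (x := (χ.trans e) x) (ε := ε)), ?_, ?_, ?_⟩
  · simp at hxs ⊢
    simp [hxs, hε]
  · have : ((χ.trans e).symm.restrOpen (Metric.ball ((χ.trans e) x) ε) Metric.isOpen_ball).symm.target
        = Metric.ball ((χ.trans e) x) ε := by
      rw [OpenPartialHomeomorph.symm_target, OpenPartialHomeomorph.restrOpen_source]
      exact Set.inter_eq_right.2 hball
    rw [this]
    exact convex_ball _ _
  · intro y hy
    have hy' : y ∈ χ.source := by
      simp at hy
      exact hy.1.1
    change π (e (χ y)) = f y
    rw [heΨ]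
    simp [Ψ, hπσ, hπL, χ.left_inv hy']

end InverseFunction

section FibreComponents

variable {X Y : Type*} [TopologicalSpace X] {μ : X → Y} {x y : X}

theorem fibreComponents_of_isPreconnected {s : Set X} (hs : IsPreconnected s) {c : Y}
    (hc : ∀ z ∈ s, μ z = c) (hx : x ∈ s) (hy : y ∈ s) : fibreComponents μ x y := by
  change connectedComponentIn (μ ⁻¹' {μ x}) x = connectedComponentIn (μ ⁻¹' {μ y}) y
  rw [hc x hx, hc y hy]
  exact connectedComponentIn_eq (hs.subset_connectedComponentIn hx hc hy)

theorem mem_connectedComponentIn_of_fibreComponents (h : fibreComponents μ x y) :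
    y ∈ connectedComponentIn (μ ⁻¹' {μ x}) x := by
  have h' : connectedComponentIn (μ ⁻¹' {μ x}) x = connectedComponentIn (μ ⁻¹' {μ y}) y := h
  rw [h']
  exact mem_connectedComponentIn rfl

theorem apply_eq_of_fibreComponents (h : fibreComponents μ x y) : μ y = μ x :=
  show y ∈ μ ⁻¹' {μ x} from
    connectedComponentIn_subset _ _ (mem_connectedComponentIn_of_fibreComponents h)

end FibreComponents

section Submersion

variable {F E : Type*} [NormedAddCommGroup F] [NormedSpace ℂ F]
  [NormedAddCommGroup E] [NormedSpace ℂ E]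
  {X : Type*} [TopologicalSpace X] [ChartedSpace F X]

/-- The charts with convex target in which the map `f` is the linear map `π`. -/
def straighteningCharts (f : X → E) (π : F →L[ℂ] E) : Set (OpenPartialHomeomorph X F) :=
  {φ | φ ∈ IsManifold.maximalAtlas 𝓘(ℂ, F) ω X ∧ Convex ℝ φ.target ∧
    ∀ y ∈ φ.source, π (φ y) = f y}

variable {f : X → E} {π : F →L[ℂ] E} {φ : OpenPartialHomeomorph X F}

theorem sub_mem_ker_iff_of_mem_straighteningCharts (hφ : φ ∈ straighteningCharts f π) {x y : X}
    (hx : x ∈ φ.source) (hy : y ∈ φ.source) :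
    φ y - φ x ∈ LinearMap.ker π.toLinearMap ↔ f y = f x := by
  rw [LinearMap.mem_ker, ContinuousLinearMap.coe_coe, map_sub, hφ.2.2 y hy, hφ.2.2 x hx,
    sub_eq_zero]

theorem isPreconnected_plaque (hφ : φ ∈ straighteningCharts f π) (x : X) :
    IsPreconnected {y | y ∈ φ.source ∧ φ y - φ x ∈ LinearMap.ker π.toLinearMap} := by
  have hconv : Convex ℝ (φ.target ∩ {z | π z = π (φ x)}) :=
    hφ.2.1.inter (convex_singleton (𝕜 := ℝ) (π (φ x)) |>.is_linear_preimage
      (f := π) (π.toLinearMap.restrictScalars ℝ).isLinear)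
  have himage : {y | y ∈ φ.source ∧ φ y - φ x ∈ LinearMap.ker π.toLinearMap} =
      φ.symm '' (φ.target ∩ {z | π z = π (φ x)}) := by
    ext y
    constructor
    · rintro ⟨hy, hy'⟩
      refine ⟨φ y, ⟨φ.map_source hy, ?_⟩, φ.left_inv hy⟩
      simpa [sub_eq_zero] using hy'
    · rintro ⟨z, ⟨hz, hz'⟩, rfl⟩
      refine ⟨φ.map_target hz, ?_⟩
      simpa [sub_eq_zero, φ.right_inv hz] using hz'
  rw [himage]
  exact hconv.isPreconnected.image _ (φ.symm.continuousOn.mono Set.inter_subset_left)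

theorem fibreComponents_of_mem_plaque (hφ : φ ∈ straighteningCharts f π) {x y : X}
    (hx : x ∈ φ.source) (hy : y ∈ φ.source) (hxy : f y = f x) : fibreComponents f x y :=
  fibreComponents_of_isPreconnected (isPreconnected_plaque hφ x) (c := f x)
    (fun z hz => (sub_mem_ker_iff_of_mem_straighteningCharts hφ hx hz.1).1 hz.2)
    ⟨hx, by simp⟩ ⟨hy, (sub_mem_ker_iff_of_mem_straighteningCharts hφ hx hy).2 hxy⟩

/-- The components of the fibres of a map that is locally the linear map `π` are the leaves of a
foliation. -/
theorem isHolomorphicFoliation_fibreComponents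
    (hcover : ∀ x, ∃ φ ∈ straighteningCharts f π, x ∈ φ.source) :
    IsHolomorphicFoliation F (fibreComponents f)
      (Module.finrank ℂ (LinearMap.ker π.toLinearMap)) := by
  refine ⟨LinearMap.ker π.toLinearMap, straighteningCharts f π, rfl, fun φ hφ => hφ.1, hcover,
    fun φ hφ x _ => isPreconnected_plaque hφ x, ?_, fun x y => ⟨fun h => ?_, fun h => ?_⟩⟩
  · intro φ hφ ψ hψ x hx
    filter_upwards [φ.open_source.mem_nhds hx.1, ψ.open_source.mem_nhds hx.2] with y hy hy'
    rw [sub_mem_ker_iff_of_mem_straighteningCharts hφ hx.1 hy,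
      sub_mem_ker_iff_of_mem_straighteningCharts hψ hx.2 hy']
  · refine (isPreconnected_connectedComponentIn (F := f ⁻¹' {f x}) (x := x)).induction₂
      (Relation.EqvGen (fun a b => ∃ φ ∈ straighteningCharts f π, a ∈ φ.source ∧ b ∈ φ.source ∧
        φ b - φ a ∈ LinearMap.ker π.toLinearMap)) ?_ (fun a b c _ _ _ h₁ h₂ => h₁.trans _ _ _ h₂)
      (fun a b _ _ h₁ => h₁.symm) (mem_connectedComponentIn rfl)
      (mem_connectedComponentIn_of_fibreComponents h)
    intro a ha
    obtain ⟨φ, hφ, haφ⟩ := hcover a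
    filter_upwards [self_mem_nhdsWithin,
      mem_nhdsWithin_of_mem_nhds (φ.open_source.mem_nhds haφ)] with b hb hbφ
    refine .rel _ _ ⟨φ, hφ, haφ, hbφ, ?_⟩
    rw [sub_mem_ker_iff_of_mem_straighteningCharts hφ haφ hbφ]
    have h₁ : a ∈ f ⁻¹' {f x} := connectedComponentIn_subset _ _ ha
    have h₂ : b ∈ f ⁻¹' {f x} := connectedComponentIn_subset _ _ hb
    exact Eq.trans h₂ (Eq.symm h₁)
  · induction h with
    | rel a b h =>
      obtain ⟨φ, hφ, ha, hb, hab⟩ := h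
      exact fibreComponents_of_mem_plaque hφ ha hb
        ((sub_mem_ker_iff_of_mem_straighteningCharts hφ ha hb).1 hab)
    | refl a => exact (fibreComponents f).refl a
    | symm a b _ h => exact (fibreComponents f).symm h
    | trans a b c _ _ h₁ h₂ => exact (fibreComponents f).trans h₁ h₂

/-- The range of a map that is locally the surjection `π` has interior points. -/
theorem exists_isOpen_subset_range (hφ : φ ∈ straighteningCharts f π) [CompleteSpace F]
    [CompleteSpace E] (hπ : Function.Surjective π) {x : X} (hx : x ∈ φ.source) :
    ∃ U : Set E, IsOpen U ∧ U.Nonempty ∧ U ⊆ Set.range f := by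
  refine ⟨π '' φ.target, π.isOpenMap hπ _ φ.open_target, ⟨_, φ x, φ.map_source hx, rfl⟩, ?_⟩
  rintro _ ⟨z, hz, rfl⟩
  refine ⟨φ.symm z, ?_⟩
  rw [← hφ.2.2 _ (φ.map_target hz), φ.right_inv hz]

theorem leafTangentSpace_fibreComponents [IsManifold 𝓘(ℂ, F) ω X]
    (hf : ContMDiff 𝓘(ℂ, F) 𝓘(ℂ, E) ω f) {x : X}
    (hφ : φ ∈ straighteningCharts f π) (hx : x ∈ φ.source) (w : TangentSpace 𝓘(ℂ, F) x) :
    w ∈ leafTangentSpace F (fibreComponents f) x ↔ mfderiv 𝓘(ℂ, F) 𝓘(ℂ, E) f x w = 0 := by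
  have hfd : ∀ z, MDifferentiableAt 𝓘(ℂ, F) 𝓘(ℂ, E) f z := fun z => hf.mdifferentiableAt (by simp)
  constructor
  · intro hw
    suffices leafTangentSpace F (fibreComponents f) x ≤
        LinearMap.ker (mfderiv 𝓘(ℂ, F) 𝓘(ℂ, E) f x).toLinearMap from this hw
    refine Submodule.span_le.2 ?_
    rintro _ ⟨γ, rfl, hγ, hs, rfl⟩
    have hcomp := mfderiv_comp (0 : ℂ) (hfd (γ 0)) (hγ.mdifferentiableAt (by simp))
    have hconst : f ∘ γ =ᶠ[𝓝 (0 : ℂ)] fun _ => f (γ 0) := by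
      filter_upwards [hs] with t ht using
        apply_eq_of_fibreComponents (μ := f) (x := γ 0) (y := γ t) ht
    have h := DFunLike.congr_fun (hcomp.symm.trans hconst.mfderiv_eq) (1 : ℂ)
    refine h.trans ?_
    rw [mfderiv_const]
    rfl
  · intro hw
    have hφs := contMDiffAt_symm_of_mem_maximalAtlas hφ.1 (φ.map_source hx)
    have hφx := contMDiffAt_of_mem_maximalAtlas hφ.1 hx
    have hφd : MDifferentiableAt 𝓘(ℂ, F) 𝓘(ℂ, F) φ x := hφx.mdifferentiableAt (by simp)
    have hφsd : MDifferentiableAt 𝓘(ℂ, F) 𝓘(ℂ, F) φ.symm (φ x) :=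
      hφs.mdifferentiableAt (by simp)
    let w' : F := mfderiv 𝓘(ℂ, F) 𝓘(ℂ, F) φ x w
    have hw' : π w' = 0 := by
      have h₁ : HasMFDerivAt 𝓘(ℂ, F) 𝓘(ℂ, E) (π ∘ φ) x
          (π.comp (mfderiv 𝓘(ℂ, F) 𝓘(ℂ, F) φ x)) :=
        HasMFDerivAt.comp x π.hasMFDerivAt hφd.hasMFDerivAt
      have h₂ : π ∘ φ =ᶠ[𝓝 x] f := by
        filter_upwards [φ.open_source.mem_nhds hx] with y hy using hφ.2.2 y hy
      have h₃ := DFunLike.congr_fun (h₁.mfderiv.symm.trans h₂.mfderiv_eq) w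
      exact h₃.trans hw
    let line : ℂ → F := fun t => φ x + t • w'
    have hline0 : line 0 = φ x := by simp [line]
    have hline : ContDiff ℂ ω line := by fun_prop
    have hlined : HasFDerivAt line ((1 : ℂ →L[ℂ] ℂ).smulRight w') 0 := by
      have := ((hasFDerivAt_id (𝕜 := ℂ) (0 : ℂ)).smul_const w').const_add (φ x)
      exact this
    refine Submodule.subset_span ⟨fun t => φ.symm (line t), ?_, ?_, ?_, ?_⟩
    · simp [line, φ.left_inv hx]
    · rw [← hline0] at hφs
      exact hφs.comp (0 : ℂ) hline.contMDiff.contMDiffAt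
    · have hmem : ∀ᶠ t in 𝓝 (0 : ℂ), line t ∈ φ.target := by
        refine hline.continuous.continuousAt.eventually_mem ?_
        rw [hline0]
        exact φ.open_target.mem_nhds (φ.map_source hx)
      filter_upwards [hmem] with t ht
      refine fibreComponents_of_mem_plaque hφ hx (φ.map_target ht) ?_
      rw [← hφ.2.2 _ (φ.map_target ht), ← hφ.2.2 _ hx, φ.right_inv ht]
      simp [line, hw']
    · have h₁ : HasMFDerivAt 𝓘(ℂ, ℂ) 𝓘(ℂ, F) (φ.symm ∘ line) 0
          ((mfderiv 𝓘(ℂ, F) 𝓘(ℂ, F) φ.symm (line 0)).comp ((1 : ℂ →L[ℂ] ℂ).smulRight w')) := by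
        refine HasMFDerivAt.comp (0 : ℂ) ?_ hlined.hasMFDerivAt
        rw [hline0]
        exact hφsd.hasMFDerivAt
      have h₂ : mfderiv 𝓘(ℂ, ℂ) 𝓘(ℂ, F) (fun t => φ.symm (line t)) 0 (1 : ℂ) =
          (mfderiv 𝓘(ℂ, F) 𝓘(ℂ, F) φ.symm (line 0)) w' := by
        refine (DFunLike.congr_fun h₁.mfderiv (1 : ℂ)).trans ?_
        change (mfderiv 𝓘(ℂ, F) 𝓘(ℂ, F) φ.symm (line 0)) ((1 : ℂ) • w') = _
        rw [one_smul]
      refine Eq.trans ?_ h₂.symm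
      have h₃ : HasMFDerivAt 𝓘(ℂ, F) 𝓘(ℂ, F) (φ.symm ∘ φ) x
          ((mfderiv 𝓘(ℂ, F) 𝓘(ℂ, F) φ.symm (φ x)).comp (mfderiv 𝓘(ℂ, F) 𝓘(ℂ, F) φ x)) :=
        HasMFDerivAt.comp x hφsd.hasMFDerivAt hφd.hasMFDerivAt
      have h₄ : φ.symm ∘ φ =ᶠ[𝓝 x] id := by
        filter_upwards [φ.open_source.mem_nhds hx] with y hy using φ.left_inv hy
      have h₅ := DFunLike.congr_fun (h₃.mfderiv.symm.trans (h₄.mfderiv_eq.trans mfderiv_id)) w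
      have h₆ : ∀ z : F, z = φ x → (mfderiv 𝓘(ℂ, F) 𝓘(ℂ, F) φ.symm z w' : F) =
          mfderiv 𝓘(ℂ, F) 𝓘(ℂ, F) φ.symm (φ x) w' := by
        rintro _ rfl
        rfl
      exact (h₅.symm.trans (h₆ _ hline0).symm)

end Submersion

section AdjointAction

variable {E : Type*} [NormedAddCommGroup E] [NormedSpace ℂ E]
  {G : Type*} [TopologicalSpace G] [ChartedSpace E G] [Group G] [LieGroup 𝓘(ℂ, E) ω G]

theorem adjointAction_eq_fderiv (g : G) (z : GroupLieAlgebra 𝓘(ℂ, E) G) :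
    @Eq E (adjointAction g z) <|
      fderiv ℂ (fun b => chartAt E (1 : G) (g * (chartAt E (1 : G)).symm b * g⁻¹))
        (chartAt E (1 : G) 1) z := by
  have hd : MDifferentiableAt 𝓘(ℂ, E) 𝓘(ℂ, E) (fun h : G => g * h * g⁻¹) 1 :=
    (((contMDiff_const (c := g)).mul (contMDiff_id (I := 𝓘(ℂ, E)) (n := ω) (M := G))).mul
      (contMDiff_const (c := g⁻¹))).mdifferentiableAt (by simp)
  refine (DFunLike.congr_fun (mfderiv_eq_fderiv_chart hd) z).trans ?_
  have h1 : g * 1 * g⁻¹ = 1 := by group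
  simp only [h1]
  rfl

theorem mpullbackWithin_mulInvariantVectorField {a : E}
    (ha : a ∈ (chartAt E (1 : G)).target) (v : E) :
    (VectorField.mpullbackWithin 𝓘(ℂ, E) 𝓘(ℂ, E) (extChartAt 𝓘(ℂ, E) (1 : G)).symm
      (mulInvariantVectorField (I := 𝓘(ℂ, E)) (G := G) v) (Set.range 𝓘(ℂ, E)) a : E) =
      fderiv ℂ (fun b => chartAt E (1 : G)
        ((chartAt E (1 : G)).symm a * (chartAt E (1 : G)).symm b)) (chartAt E (1 : G) 1) v := by
  have : IsManifold 𝓘(ℂ, E) 1 G := IsManifold.of_le (n := ω) (by simp)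
  have hχ : chartAt E (1 : G) ∈ IsManifold.maximalAtlas 𝓘(ℂ, E) ω G :=
    IsManifold.chart_mem_maximalAtlas 1
  have ha' : a ∈ (extChartAt 𝓘(ℂ, E) (1 : G)).target := by simpa using ha
  rw [VectorField.mpullbackWithin_apply, ContinuousLinearMap.inverse_eq
    (mfderivWithin_extChartAt_symm_comp_mfderiv_extChartAt ha')
    (mfderiv_extChartAt_comp_mfderivWithin_extChartAt_symm ha')]
  set g : G := (chartAt E (1 : G)).symm a with hg
  have hgs : g * 1 ∈ (chartAt E (1 : G)).source := by
    rw [mul_one]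
    exact (chartAt E (1 : G)).map_target ha
  have hL : ContMDiff 𝓘(ℂ, E) 𝓘(ℂ, E) ω (fun h : G => g * h) := contMDiff_mul_left
  have hLd := hL.mdifferentiableAt (x := 1) (by simp)
  have hχd : MDifferentiableAt 𝓘(ℂ, E) 𝓘(ℂ, E) (chartAt E (1 : G)) (g * 1) :=
    (contMDiffAt_of_mem_maximalAtlas hχ hgs).mdifferentiableAt (by simp)
  have hcomp := mfderiv_comp (1 : G) hχd hLd
  have hchart := mfderiv_eq_fderiv_chart (hχd.comp (1 : G) hLd)
  have h₁ := DFunLike.congr_fun (hcomp.symm.trans hchart) v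
  refine Eq.trans ?_ h₁
  change mfderiv 𝓘(ℂ, E) 𝓘(ℂ, E) (chartAt E (1 : G)) g
    (mfderiv 𝓘(ℂ, E) 𝓘(ℂ, E) (fun h : G => g * h) 1 v) =
    mfderiv 𝓘(ℂ, E) 𝓘(ℂ, E) (chartAt E (1 : G)) (g * 1)
    (mfderiv 𝓘(ℂ, E) 𝓘(ℂ, E) (fun h : G => g * h) 1 v)
  have h₂ : ∀ g' : G, g' = g → ∀ u : E,
      (mfderiv 𝓘(ℂ, E) 𝓘(ℂ, E) (chartAt E (1 : G)) g u : E) =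
      mfderiv 𝓘(ℂ, E) 𝓘(ℂ, E) (chartAt E (1 : G)) g' u := by
    rintro _ rfl u
    rfl
  exact h₂ _ (mul_one g) _

theorem bracket_eq_lieBracket_chart (y z : GroupLieAlgebra 𝓘(ℂ, E) G) :
    @Eq E (⁅y, z⁆ : GroupLieAlgebra 𝓘(ℂ, E) G) <|
      VectorField.lieBracket ℂ
        (fun a => fderiv ℂ (fun b => chartAt E (1 : G)
          ((chartAt E (1 : G)).symm a * (chartAt E (1 : G)).symm b)) (chartAt E (1 : G) 1) y)
        (fun a => fderiv ℂ (fun b => chartAt E (1 : G)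
          ((chartAt E (1 : G)).symm a * (chartAt E (1 : G)).symm b)) (chartAt E (1 : G) 1) z)
        (chartAt E (1 : G) 1) := by
  have : IsManifold 𝓘(ℂ, E) 1 G := IsManifold.of_le (n := ω) (by simp)
  have hinv : ∀ u : E, @Eq E ((mfderiv 𝓘(ℂ, E) 𝓘(ℂ, E)
      (extChartAt 𝓘(ℂ, E) (1 : G)) 1).inverse u) u := fun u =>
    (DFunLike.congr_fun (congrArg ContinuousLinearMap.inverse
      (mfderiv_extChartAt_self (I := 𝓘(ℂ, E)) (x := (1 : G)))) u).trans
      (DFunLike.congr_fun (ContinuousLinearMap.inverse_id (R := ℂ) (M := E)) u)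
  refine (hinv _).trans ?_
  have hset : (extChartAt 𝓘(ℂ, E) (1 : G)).symm ⁻¹' Set.univ ∩ Set.range 𝓘(ℂ, E) = Set.univ := by
    simp
  rw [hset]
  refine (congrFun (VectorField.lieBracketWithin_univ (𝕜 := ℂ) (E := E)) _).trans ?_
  have hev : ∀ v : E, (VectorField.mpullbackWithin 𝓘(ℂ, E) 𝓘(ℂ, E)
      (extChartAt 𝓘(ℂ, E) (1 : G)).symm (mulInvariantVectorField (I := 𝓘(ℂ, E)) (G := G) v)
      (Set.range 𝓘(ℂ, E)) : E → E) =ᶠ[𝓝 (chartAt E (1 : G) 1)]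
      fun a => fderiv ℂ (fun b => chartAt E (1 : G)
        ((chartAt E (1 : G)).symm a * (chartAt E (1 : G)).symm b)) (chartAt E (1 : G) 1) v := by
    intro v
    filter_upwards [(chartAt E (1 : G)).open_target.mem_nhds (mem_chart_target E (1 : G))]
      with a ha using mpullbackWithin_mulInvariantVectorField ha v
  exact Filter.EventuallyEq.lieBracket_vectorField_eq (hev y) (hev z)

/-- The differential of the adjoint representation is the bracket. -/
theorem mfderiv_adjointAction (y z : GroupLieAlgebra 𝓘(ℂ, E) G) :
    @Eq E (mfderiv (M' := E) 𝓘(ℂ, E) 𝓘(ℂ, E) (fun g : G => adjointAction g z) 1 y)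
      (⁅y, z⁆ : GroupLieAlgebra 𝓘(ℂ, E) G) := by
  set χ := chartAt E (1 : G) with hχdef
  have hχ : χ ∈ IsManifold.maximalAtlas 𝓘(ℂ, E) ω G := IsManifold.chart_mem_maximalAtlas 1
  have h1 : (1 : G) ∈ χ.source := mem_chart_source E 1
  have he : χ 1 ∈ χ.target := χ.map_source h1
  have hs1 : χ.symm (χ 1) = 1 := χ.left_inv h1
  have hfst : ContMDiffAt 𝓘(ℂ, E × E) 𝓘(ℂ, E) ω (fun p : E × E => χ.symm p.1) (χ 1, χ 1) :=
    (contMDiffAt_symm_of_mem_maximalAtlas hχ he).comp (χ 1, χ 1) contDiff_fst.contMDiff.contMDiffAt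
  have hsnd : ContMDiffAt 𝓘(ℂ, E × E) 𝓘(ℂ, E) ω (fun p : E × E => χ.symm p.2) (χ 1, χ 1) :=
    (contMDiffAt_symm_of_mem_maximalAtlas hχ he).comp (χ 1, χ 1) contDiff_snd.contMDiff.contMDiffAt
  have hmul := hfst.mul hsnd
  have hconj := hmul.mul hfst.inv
  have hm : ContDiffAt ℂ ω (fun p : E × E => χ (χ.symm p.1 * χ.symm p.2)) (χ 1, χ 1) := by
    rw [← contMDiffAt_iff_contDiffAt]
    refine ContMDiffAt.comp (χ 1, χ 1) ?_ hmul
    simpa [hs1] using contMDiffAt_of_mem_maximalAtlas hχ h1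
  have hc : ContDiffAt ℂ ω (fun p : E × E => χ (χ.symm p.1 * χ.symm p.2 * (χ.symm p.1)⁻¹))
      (χ 1, χ 1) := by
    rw [← contMDiffAt_iff_contDiffAt]
    refine ContMDiffAt.comp (χ 1, χ 1) ?_ hconj
    simpa [hs1] using contMDiffAt_of_mem_maximalAtlas hχ h1
  have htarget := χ.open_target.mem_nhds he
  have hcm : ∀ᶠ p : E × E in 𝓝 (χ 1, χ 1),
      χ (χ.symm (χ (χ.symm p.1 * χ.symm p.2 * (χ.symm p.1)⁻¹)) * χ.symm p.1) =
      χ (χ.symm p.1 * χ.symm p.2) := by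
    have hmem := hconj.continuousAt.eventually_mem (s := χ.source)
      (χ.open_source.mem_nhds (by simpa [hs1] using h1))
    filter_upwards [hmem] with p hp
    have hp' : χ.symm p.1 * χ.symm p.2 * (χ.symm p.1)⁻¹ ∈ χ.source := hp
    rw [χ.left_inv hp', inv_mul_cancel_right]
  obtain ⟨hd, hbr'⟩ := fderiv_conj_eq_lieBracket
    (m := fun p : E × E => χ (χ.symm p.1 * χ.symm p.2))
    (c := fun p : E × E => χ (χ.symm p.1 * χ.symm p.2 * (χ.symm p.1)⁻¹)) (e := χ 1)
    (hm.of_le (by simp)) (hc.of_le (by simp)) hcm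
    (by filter_upwards with a; simp [hs1])
    (by filter_upwards [htarget] with b hb; simp [hs1, χ.right_inv hb])
    (by filter_upwards [htarget] with b hb; simp [hs1, χ.right_inv hb])
    (by filter_upwards [htarget] with b hb; simp [hs1, χ.right_inv hb]) y z
  have hcoord : HasMFDerivAt (M' := E) 𝓘(ℂ, E) 𝓘(ℂ, E) (fun g : G => adjointAction g z) 1
      ((fderiv ℂ (fun a => fderiv ℂ (fun b => χ (χ.symm a * χ.symm b * (χ.symm a)⁻¹)) (χ 1) z)
        (χ 1)).comp (mfderiv 𝓘(ℂ, E) 𝓘(ℂ, E) χ 1)) := by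
    have hχd : MDifferentiableAt 𝓘(ℂ, E) 𝓘(ℂ, E) χ 1 :=
      (contMDiffAt_of_mem_maximalAtlas hχ h1).mdifferentiableAt (by simp)
    refine (HasMFDerivAt.comp (1 : G) hd.hasMFDerivAt hχd.hasMFDerivAt).congr_of_eventuallyEq ?_
    filter_upwards [χ.open_source.mem_nhds h1] with g hg
    rw [adjointAction_eq_fderiv]
    simp only [Function.comp_apply, χ.left_inv hg]
    rfl
  have hid : ∀ y : E, (mfderiv 𝓘(ℂ, E) 𝓘(ℂ, E) χ 1 y : E) = y := by
    have : IsManifold 𝓘(ℂ, E) 1 G := IsManifold.of_le (n := ω) (by simp)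
    exact fun y => DFunLike.congr_fun (mfderiv_extChartAt_self (I := 𝓘(ℂ, E)) (x := (1 : G))) y
  refine (DFunLike.congr_fun hcoord.mfderiv y).trans ?_
  refine Eq.trans ?_ (hbr'.trans (bracket_eq_lieBracket_chart y z).symm)
  exact congrArg _ (hid y)

end AdjointAction

section Actions

variable {E : Type*} [NormedAddCommGroup E] [NormedSpace ℂ E]
  {G : Type*} [TopologicalSpace G] [ChartedSpace E G] [Group G] [LieGroup 𝓘(ℂ, E) ω G]
  {F : Type*} [NormedAddCommGroup F] [NormedSpace ℂ F]
  {X : Type*} [TopologicalSpace X] [ChartedSpace F X]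
  [MulAction G X] [ContMDiffSMul 𝓘(ℂ, E) 𝓘(ℂ, F) ω G X]

omit [LieGroup 𝓘(ℂ, E) ω G] in
theorem contMDiff_orbitMap [IsManifold 𝓘(ℂ, E) ω G] (x : X) :
    ContMDiff 𝓘(ℂ, E) 𝓘(ℂ, F) ω (fun g : G => g • x) :=
  contMDiff_id.smul contMDiff_const

/-- The derivative of a function along an orbit is its derivative along a fundamental vector
field. -/
theorem mfderiv_comp_orbitMap {E' : Type*} [NormedAddCommGroup E'] [NormedSpace ℂ E']
    {f : X → E'} {x : X} (hf : MDifferentiableAt 𝓘(ℂ, F) 𝓘(ℂ, E') f x)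
    (y : GroupLieAlgebra 𝓘(ℂ, E) G) :
    @Eq E' (mfderiv 𝓘(ℂ, E) 𝓘(ℂ, E') (fun g : G => f (g • x)) 1 y)
      (mfderiv 𝓘(ℂ, F) 𝓘(ℂ, E') f x (fundamentalVectorField y x)) := by
  have horbit := (contMDiff_orbitMap (E := E) (F := F) (G := G) x).mdifferentiableAt
    (x := 1) (by simp)
  have hf' : MDifferentiableAt 𝓘(ℂ, F) 𝓘(ℂ, E') f ((1 : G) • x) := by rwa [one_smul]
  refine (DFunLike.congr_fun (mfderiv_comp (1 : G) hf' horbit) y).trans ?_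
  have h : ∀ x' : X, x' = x → ∀ u : F, @Eq E' (mfderiv 𝓘(ℂ, F) 𝓘(ℂ, E') f x' u)
      (mfderiv 𝓘(ℂ, F) 𝓘(ℂ, E') f x u) := by
    rintro _ rfl u
    rfl
  exact h _ (one_smul G x) _

variable (E G) in
omit [LieGroup 𝓘(ℂ, E) ω G] [ContMDiffSMul 𝓘(ℂ, E) 𝓘(ℂ, F) ω G X] in
/-- The infinitesimal action at `x`, sending `y` to the fundamental vector field of `y` at `x`. -/
def infinitesimalAction (x : X) : GroupLieAlgebra 𝓘(ℂ, E) G →ₗ[ℂ] TangentSpace 𝓘(ℂ, F) x where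
  toFun y := fundamentalVectorField y x
  map_add' y z := map_add (mfderiv 𝓘(ℂ, E) 𝓘(ℂ, F) (fun g : G => g • x) 1) y z
  map_smul' c y := map_smul (mfderiv 𝓘(ℂ, E) 𝓘(ℂ, F) (fun g : G => g • x) 1) c y

theorem fundamentalVectorField_eq_fderiv (y : GroupLieAlgebra 𝓘(ℂ, E) G) (x : X) :
    @Eq F (fundamentalVectorField y x) <|
      fderiv ℂ (fun u => chartAt F x ((chartAt E (1 : G)).symm u • x)) (chartAt E (1 : G) 1) y := by
  have horbit := (contMDiff_orbitMap (E := E) (F := F) (G := G) x).mdifferentiableAt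
    (x := 1) (by simp)
  refine (DFunLike.congr_fun (mfderiv_eq_fderiv_chart horbit) y).trans ?_
  simp only [one_smul]
  rfl

/-- A slice to the orbits: for a locally free action, there are charts around every point and a
projection `p` with `dim G`-dimensional kernel such that `p ∘ φ` is locally constant along the
orbits. -/
theorem exists_chart_orbit_invariant [FiniteDimensional ℂ E] [FiniteDimensional ℂ F]
    [IsManifold 𝓘(ℂ, F) ω X] (hfree : IsLocallyFreeAction E G F X) (x₀ : X) :
    ∃ φ ∈ IsManifold.maximalAtlas 𝓘(ℂ, F) ω X, x₀ ∈ φ.source ∧ ∃ p : F →L[ℂ] F,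
      Module.finrank ℂ (LinearMap.ker p.toLinearMap) = Module.finrank ℂ E ∧
      ∀ x ∈ φ.source, ∀ᶠ g in 𝓝 (1 : G), p (φ (g • x)) = p (φ x) := by
  set χ := chartAt F x₀ with hχdef
  set χG := chartAt E (1 : G) with hχGdef
  have hχ : χ ∈ IsManifold.maximalAtlas 𝓘(ℂ, F) ω X := IsManifold.chart_mem_maximalAtlas x₀
  have hχG : χG ∈ IsManifold.maximalAtlas 𝓘(ℂ, E) ω G := IsManifold.chart_mem_maximalAtlas 1
  have h1 : (1 : G) ∈ χG.source := mem_chart_source E 1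
  have hx₀ : x₀ ∈ χ.source := mem_chart_source F x₀
  have hs1 : χG.symm (χG 1) = 1 := χG.left_inv h1
  have hsx : χ.symm (χ x₀) = x₀ := χ.left_inv hx₀
  let a : E →ₗ[ℂ] F := infinitesimalAction (F := F) E G x₀
  have ha : Function.Injective a := by
    refine (injective_iff_map_eq_zero a).2 fun y hy => ?_
    exact hfree x₀ y hy
  obtain ⟨b, hb⟩ := a.exists_leftInverse_of_injective (LinearMap.ker_eq_bot.2 ha)
  have hba : ∀ u, b (a u) = u := fun u => LinearMap.congr_fun hb u
  let b' : F →L[ℂ] E := LinearMap.toContinuousLinearMap b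
  let a' : E →L[ℂ] F := LinearMap.toContinuousLinearMap a
  let p : F →L[ℂ] F := ContinuousLinearMap.id ℂ F - a'.comp b'
  have hp : ∀ z, p z = z - a (b z) := fun z => rfl
  have hker : LinearMap.ker p.toLinearMap = LinearMap.range a := by
    ext z
    rw [LinearMap.mem_ker, ContinuousLinearMap.coe_coe, hp, sub_eq_zero]
    constructor
    · intro h
      exact ⟨b z, h.symm⟩
    · rintro ⟨u, rfl⟩
      rw [hba]
  let A : E × F → X := fun q => χG.symm q.1 • χ.symm q.2
  have hA : ContMDiffAt 𝓘(ℂ, E × F) 𝓘(ℂ, F) ω A (χG 1, χ x₀) :=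
    ((contMDiffAt_symm_of_mem_maximalAtlas hχG (χG.map_source h1)).comp (χG 1, χ x₀)
      contDiff_fst.contMDiff.contMDiffAt).smul
      ((contMDiffAt_symm_of_mem_maximalAtlas hχ (χ.map_source hx₀)).comp (χG 1, χ x₀)
      contDiff_snd.contMDiff.contMDiffAt)
  have hA₀ : A (χG 1, χ x₀) = x₀ := by simp [A, hs1, hsx]
  have hK : ContDiffAt ℂ ω (χ ∘ A) (χG 1, χ x₀) := by
    rw [← contMDiffAt_iff_contDiffAt]
    refine ContMDiffAt.comp (χG 1, χ x₀) ?_ hA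
    rw [hA₀]
    exact contMDiffAt_of_mem_maximalAtlas hχ hx₀
  let ι : F → E × F := fun z => (χG 1 + b' z, χ x₀ + p z)
  have hι0 : ι 0 = (χG 1, χ x₀) := by simp [ι]
  have hι : ContDiff ℂ ω ι :=
    (contDiff_const.add b'.contDiff).prodMk (contDiff_const.add p.contDiff)
  have hι' : HasFDerivAt ι (b'.prod p) 0 :=
    (b'.hasFDerivAt.const_add _).prodMk (p.hasFDerivAt.const_add _)
  let Θ : F → F := fun z => χ (A (ι z))
  have hΘ : ContDiffAt ℂ ω Θ 0 := by
    rw [← hι0] at hK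
    exact hK.comp 0 hι.contDiffAt
  have hΘ0 : Θ 0 = χ x₀ := by simp only [Θ, hι0, hA₀]
  have hKd : HasFDerivAt (χ ∘ A) (fderiv ℂ (χ ∘ A) (χG 1, χ x₀)) (χG 1, χ x₀) :=
    (hK.differentiableAt (by simp)).hasFDerivAt
  have hK₁ : ∀ u, fderiv ℂ (χ ∘ A) (χG 1, χ x₀) (u, 0) = a u := by
    intro u
    have h₁ : HasFDerivAt (fun u : E => (u, χ x₀)) (ContinuousLinearMap.inl ℂ E F) (χG 1) :=
      hasFDerivAt_prodMk_left _ _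
    have h₂ := (hKd.comp (f := fun u : E => (u, χ x₀)) (χG 1) h₁).fderiv
    have h₃ : (χ ∘ A) ∘ (fun u : E => (u, χ x₀)) = fun u => χ (χG.symm u • x₀) := by
      ext u
      simp [A, hsx]
    rw [h₃] at h₂
    have h₄ := fundamentalVectorField_eq_fderiv (E := E) (G := G) (F := F) u x₀
    refine Eq.trans ?_ h₄.symm
    change _ = fderiv ℂ (fun u => χ (χG.symm u • x₀)) (χG 1) u
    rw [h₂]
    simp
  have hK₂ : ∀ s, fderiv ℂ (χ ∘ A) (χG 1, χ x₀) (0, s) = s := by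
    intro s
    have h₁ : HasFDerivAt (fun s : F => (χG 1, s)) (ContinuousLinearMap.inr ℂ E F) (χ x₀) :=
      hasFDerivAt_prodMk_right _ _
    have h₂ := hKd.comp (f := fun s : F => (χG 1, s)) (χ x₀) h₁
    have h₃ : (χ ∘ A) ∘ (fun s : F => (χG 1, s)) =ᶠ[𝓝 (χ x₀)] id := by
      filter_upwards [χ.open_target.mem_nhds (χ.map_source hx₀)] with s hs
      simp [A, hs1, χ.right_inv hs]
    have h₄ := DFunLike.congr_fun
      ((h₂.congr_of_eventuallyEq h₃.symm).unique (hasFDerivAt_id (χ x₀))) s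
    simpa using h₄
  have hΘ' : fderiv ℂ Θ 0 = ContinuousLinearMap.id ℂ F := by
    have h₁ : HasFDerivAt (χ ∘ A) (fderiv ℂ (χ ∘ A) (χG 1, χ x₀)) (ι 0) := by rwa [hι0]
    have h₂ : HasFDerivAt Θ _ 0 := h₁.comp 0 hι'
    rw [h₂.fderiv]
    ext z
    have h₃ : ((b' z, p z) : E × F) = (b' z, 0) + (0, p z) := by simp
    change fderiv ℂ (χ ∘ A) (χG 1, χ x₀) (b' z, p z) = z
    rw [h₃, map_add, hK₁, hK₂, hp]
    change a (b z) + _ = z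
    abel
  obtain ⟨e₀, he0, heΘ, he, he'⟩ := exists_openPartialHomeomorph_of_injective_fderiv hΘ
    (by rw [hΘ']; exact fun _ _ h => h)
  have hgood : ∀ᶠ z in 𝓝 (0 : F), (ι z).1 ∈ χG.target ∧ (ι z).2 ∈ χ.target ∧
      A (ι z) ∈ χ.source := by
    have hc : ContinuousAt ι 0 := hι.continuous.continuousAt
    have hAc : ContinuousAt (A ∘ ι) 0 := by
      refine ContinuousAt.comp ?_ hc
      rw [hι0]
      exact hA.continuousAt
    refine (hc.fst.eventually_mem ?_).and ((hc.snd.eventually_mem ?_).and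
      (hAc.eventually_mem ?_))
    · rw [hι0]
      exact χG.open_target.mem_nhds (χG.map_source h1)
    · rw [hι0]
      exact χ.open_target.mem_nhds (χ.map_source hx₀)
    · simp only [Function.comp_apply, hι0, hA₀]
      exact χ.open_source.mem_nhds hx₀
  obtain ⟨s, hs, hso, h0s⟩ := eventually_nhds_iff.1 hgood
  let e := e₀.restrOpen s hso
  have hes : e.source = e₀.source ∩ s := e₀.restrOpen_source s hso
  have heΘ' : ∀ z, e z = Θ z := fun z => congrFun heΘ z
  have hesymm : ContDiffOn ℂ ω e.symm e.target :=
    he'.mono fun z hz => by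
      simp [e] at hz
      exact hz.1
  have hφ := trans_mem_maximalAtlas_of_contDiffOn hχ (e := e.symm) hesymm
    (he.mono (by rw [OpenPartialHomeomorph.symm_target, hes]; exact Set.inter_subset_left))
  have h0e : (0 : F) ∈ e.source := by
    rw [hes]
    exact ⟨he0, h0s⟩
  refine ⟨_, hφ, ?_, p, ?_, ?_⟩
  · rw [OpenPartialHomeomorph.trans_source]
    refine ⟨hx₀, ?_⟩
    change χ x₀ ∈ e.target
    rw [← hΘ0, ← heΘ']
    exact e.map_source h0e
  · rw [hker, LinearMap.finrank_range_of_inj ha]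
  · intro x hx
    rw [OpenPartialHomeomorph.trans_source] at hx
    obtain ⟨hxχ, hxe⟩ := hx
    change χ x ∈ e.target at hxe
    set z := e.symm (χ x) with hz
    have hze : z ∈ e.source := e.map_target hxe
    have hzs : z ∈ s := (hes ▸ hze : z ∈ e₀.source ∩ s).2
    obtain ⟨hz₁, hz₂, hz₃⟩ := hs z hzs
    have hxz : A (ι z) = x := by
      have h₁ : χ (A (ι z)) = χ x := by
        have := e.right_inv hxe
        rwa [heΘ'] at this
      exact χ.injOn hz₃ hxχ h₁
    let g₀ : G := χG.symm (ι z).1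
    have hg₀ : g₀ ∈ χG.source := χG.map_target hz₁
    let z' : G → F := fun g => z + a' (χG (g * g₀) - (ι z).1)
    have hmulc : ContinuousAt (fun g : G => g * g₀) 1 := by
      have : ContMDiff 𝓘(ℂ, E) 𝓘(ℂ, E) ω (fun g : G => g * g₀) := contMDiff_mul_right
      exact this.continuous.continuousAt
    have hχc : ContinuousAt (fun g : G => χG (g * g₀)) 1 := by
      refine ContinuousAt.comp (g := χG) ?_ hmulc
      rw [one_mul]
      exact χG.continuousAt hg₀
    have hz'c : ContinuousAt z' 1 :=
      continuousAt_const.add (a'.continuous.continuousAt.comp (hχc.sub continuousAt_const))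
    have hz'1 : z' 1 = z := by
      simp only [z', one_mul, g₀, χG.right_inv hz₁, sub_self, map_zero, add_zero]
    have hev₁ : ∀ᶠ g in 𝓝 (1 : G), z' g ∈ e.source :=
      hz'c.eventually_mem (e.open_source.mem_nhds (by rwa [hz'1]))
    have hev₂ : ∀ᶠ g in 𝓝 (1 : G), g * g₀ ∈ χG.source :=
      hmulc.eventually_mem (χG.open_source.mem_nhds (by rwa [one_mul]))
    filter_upwards [hev₁, hev₂] with g hg₁ hg₂
    have hp₁ : p (z' g) = p z := by
      have : p (a' (χG (g * g₀) - (ι z).1)) = 0 := by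
        rw [hp]
        change a _ - a (b (a _)) = 0
        rw [hba, sub_self]
      simp only [z', map_add, this, add_zero]
    have hιz' : ι (z' g) = (χG (g * g₀), (ι z).2) := by
      have hb₁ : b' (z' g) = b' z + (χG (g * g₀) - (ι z).1) := by
        simp only [z', map_add]
        congr 1
        exact hba _
      refine Prod.ext ?_ ?_
      · change χG 1 + b' (z' g) = χG (g * g₀)
        rw [hb₁]
        change χG 1 + (b' z + (χG (g * g₀) - (χG 1 + b' z))) = _
        abel
      · change χ x₀ + p (z' g) = χ x₀ + p z
        rw [hp₁]
    have hAz' : A (ι (z' g)) = g • x := by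
      rw [hιz', ← hxz]
      simp only [A, χG.left_inv hg₂, mul_smul]
      rfl
    have hfin : e.symm (χ (g • x)) = z' g := by
      have h₁ : e (z' g) = χ (g • x) := by
        rw [heΘ']
        simp only [Θ, hAz']
      rw [← h₁, e.left_inv hg₁]
    change p (e.symm (χ (g • x))) = p (e.symm (χ x))
    rw [hfin, ← hz, hp₁]

/-- For a locally free action, there are locally holomorphic maps whose fibres are tangent to the
orbits. -/
theorem exists_map_ker_mfderiv_eq_orbit [FiniteDimensional ℂ E] [FiniteDimensional ℂ F]
    [IsManifold 𝓘(ℂ, F) ω X] (hfree : IsLocallyFreeAction E G F X) (x₀ : X) :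
    ∃ (U : Set X) (f : X → F), IsOpen U ∧ x₀ ∈ U ∧ ContMDiffOn 𝓘(ℂ, F) 𝓘(ℂ, F) ω f U ∧
      ∀ x ∈ U, ∀ w : TangentSpace 𝓘(ℂ, F) x, @Eq F (mfderiv 𝓘(ℂ, F) 𝓘(ℂ, F) f x w) 0 ↔
        ∃ y : GroupLieAlgebra 𝓘(ℂ, E) G, fundamentalVectorField y x = w := by
  obtain ⟨φ, hφ, hx₀, p, hp, hinv⟩ := exists_chart_orbit_invariant (G := G) hfree x₀
  refine ⟨φ.source, p ∘ φ, φ.open_source, hx₀,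
    p.contDiff.contMDiff.comp_contMDiffOn (contMDiffOn_of_mem_maximalAtlas hφ), ?_⟩
  intro x hx
  have hφd : MDifferentiableAt 𝓘(ℂ, F) 𝓘(ℂ, F) φ x :=
    (contMDiffAt_of_mem_maximalAtlas hφ hx).mdifferentiableAt (by simp)
  have hφsd : MDifferentiableAt 𝓘(ℂ, F) 𝓘(ℂ, F) φ.symm (φ x) :=
    (contMDiffAt_symm_of_mem_maximalAtlas hφ (φ.map_source hx)).mdifferentiableAt (by simp)
  have hd : HasMFDerivAt 𝓘(ℂ, F) 𝓘(ℂ, F) (p ∘ φ) x (p.comp (mfderiv 𝓘(ℂ, F) 𝓘(ℂ, F) φ x)) :=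
    HasMFDerivAt.comp x p.hasMFDerivAt hφd.hasMFDerivAt
  let D : TangentSpace 𝓘(ℂ, F) x →ₗ[ℂ] F := (mfderiv 𝓘(ℂ, F) 𝓘(ℂ, F) φ x).toLinearMap
  have hDinj : Function.Injective D := by
    have h₃ : HasMFDerivAt 𝓘(ℂ, F) 𝓘(ℂ, F) (φ.symm ∘ φ) x
        ((mfderiv 𝓘(ℂ, F) 𝓘(ℂ, F) φ.symm (φ x)).comp (mfderiv 𝓘(ℂ, F) 𝓘(ℂ, F) φ x)) :=
      HasMFDerivAt.comp x hφsd.hasMFDerivAt hφd.hasMFDerivAt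
    have h₄ : φ.symm ∘ φ =ᶠ[𝓝 x] id := by
      filter_upwards [φ.open_source.mem_nhds hx] with y hy using φ.left_inv hy
    refine (injective_iff_map_eq_zero D).2 fun w hw => ?_
    have h₅ := DFunLike.congr_fun (h₃.mfderiv.symm.trans (h₄.mfderiv_eq.trans mfderiv_id)) w
    refine h₅.symm.trans ?_
    change mfderiv 𝓘(ℂ, F) 𝓘(ℂ, F) φ.symm (φ x) (D w) = 0
    rw [hw]
    exact map_zero (mfderiv 𝓘(ℂ, F) 𝓘(ℂ, F) φ.symm (φ x))
  have hDf : ∀ w, @Eq F (mfderiv 𝓘(ℂ, F) 𝓘(ℂ, F) (p ∘ φ) x w) (p (D w)) :=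
    fun w => DFunLike.congr_fun hd.mfderiv w
  let a := infinitesimalAction (F := F) E G x
  have hle : LinearMap.range a ≤ LinearMap.ker (p.toLinearMap ∘ₗ D) := by
    rintro _ ⟨y, rfl⟩
    have h₁ := mfderiv_comp_orbitMap (G := G) hd.mdifferentiableAt y
    have h₂ : (fun g : G => (p ∘ φ) (g • x)) =ᶠ[𝓝 1] fun _ => p (φ x) := hinv x hx
    have h₃ := DFunLike.congr_fun (h₂.mfderiv_eq (I := 𝓘(ℂ, E)) (I' := 𝓘(ℂ, F))) y
    have h₄ := (hDf (a y)).symm.trans (h₁.symm.trans h₃)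
    refine h₄.trans ?_
    rw [mfderiv_const]
    rfl
  have hainj : Function.Injective a :=
    (injective_iff_map_eq_zero a).2 fun y hy => hfree x y hy
  have hrank : Module.finrank ℂ (LinearMap.ker (p.toLinearMap ∘ₗ D)) ≤
      Module.finrank ℂ (LinearMap.range a) := by
    rw [LinearMap.finrank_range_of_inj hainj]
    change _ ≤ Module.finrank ℂ E
    rw [← hp, LinearMap.ker_comp]
    refine LinearMap.finrank_le_finrank_of_injective
      (f := D.restrict (p := (LinearMap.ker p.toLinearMap).comap D)
        (q := LinearMap.ker p.toLinearMap) fun w hw => hw) ?_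
    intro u v huv
    exact Subtype.ext (hDinj (congrArg Subtype.val huv))
  have heq := Submodule.eq_of_le_of_finrank_le hle hrank
  intro w
  have h := congrArg (w ∈ ·) heq
  simp only [LinearMap.mem_range, LinearMap.mem_ker, eq_iff_iff] at h
  rw [hDf w]
  exact h.symm

end Actions

section LinearAlgebra

variable {T L : Type*} [AddCommGroup T] [Module ℂ T] [FiniteDimensional ℂ T]
  {B : LinearMap.BilinForm ℂ T} {K R : Submodule ℂ T}

/-- The orthogonal of a subspace `R` is isotropic if and only if it is contained in `R`. -/
theorem isotropic_orthogonal_iff (hB : B.Nondegenerate) (hBr : B.IsRefl) :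
    (∀ v ∈ B.orthogonal R, ∀ w ∈ B.orthogonal R, B v w = 0) ↔ B.orthogonal R ≤ R := by
  constructor
  · intro h v hv
    rw [← LinearMap.BilinForm.orthogonal_orthogonal hB hBr R]
    exact fun w hw => h w hw v hv
  · exact fun h v hv w hw => hw v (h hv)

/-- The vectors that represent linear forms with common kernel `R` span the orthogonal of `R`. -/
theorem span_eq_orthogonal_of_iInf_ker_eq (hB : B.Nondegenerate) (hBr : B.IsRefl) {ι : Type*}
    [Finite ι] {α : ι → T →ₗ[ℂ] ℂ} (hα : ⨅ i, LinearMap.ker (α i) = R) :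
    Submodule.span ℂ {v | ∃ i, ∀ w, B v w = α i w} = B.orthogonal R := by
  apply le_antisymm
  · refine Submodule.span_le.2 ?_
    rintro v ⟨i, hi⟩ w hw
    refine hBr.eq_zero ?_
    rw [hi w]
    rw [← hα, Submodule.mem_iInf] at hw
    exact hw i
  · intro v hv
    let e := B.toDual hB
    have he : ∀ u w, e u w = B u w := fun u w => rfl
    have hmem : e v ∈ Submodule.span ℂ (Set.range α) := by
      refine mem_span_of_iInf_ker_le_ker ?_
      rw [hα]
      exact fun w hw => hBr.eq_zero (hv w hw)
    have hmap := Submodule.mem_map_of_mem (f := e.symm.toLinearMap) hmem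
    rw [Submodule.map_span] at hmap
    simp only [LinearEquiv.coe_coe, LinearEquiv.symm_apply_apply] at hmap
    refine Submodule.span_mono ?_ hmap
    rintro _ ⟨_, ⟨i, rfl⟩, rfl⟩
    refine ⟨i, fun w => ?_⟩
    rw [← he, LinearEquiv.apply_symm_apply]

theorem le_range_iff_finrank_eq [AddCommGroup L] [Module ℂ L] [FiniteDimensional ℂ L]
    {L' : Type*} [AddCommGroup L'] [Module ℂ L']
    {a : L →ₗ[ℂ] T} (ha : Function.Injective a) (m : T →ₗ[ℂ] L') :
    LinearMap.ker m ≤ LinearMap.range a ↔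
      Module.finrank ℂ (LinearMap.ker m) = Module.finrank ℂ (LinearMap.ker (m ∘ₗ a)) := by
  have hmap : (LinearMap.ker (m ∘ₗ a)).map a = LinearMap.range a ⊓ LinearMap.ker m := by
    rw [LinearMap.ker_comp, Submodule.map_comap_eq]
  have hrank : Module.finrank ℂ (LinearMap.ker (m ∘ₗ a)) =
      Module.finrank ℂ (LinearMap.range a ⊓ LinearMap.ker m : Submodule ℂ T) := by
    rw [← hmap]
    exact (LinearEquiv.finrank_eq (Submodule.equivMapOfInjective a ha _))
  rw [hrank]
  constructor
  · intro h
    rw [inf_eq_right.2 h]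
  · intro h
    have := Submodule.eq_of_le_of_finrank_eq (inf_le_right : LinearMap.range a ⊓ LinearMap.ker m ≤ _)
      h.symm
    exact inf_eq_right.1 this

end LinearAlgebra

section LieAlgebra

theorem LieAlgebra.isKilling_of_forall_killingForm {L : Type*} [LieRing L] [LieAlgebra ℂ L]
    (h : ∀ y : L, (∀ u, killingForm ℂ L u y = 0) → y = 0) : LieAlgebra.IsKilling ℂ L where
  killingCompl_top_eq_bot := by
    rw [eq_bot_iff]
    intro y hy
    rw [LieIdeal.mem_killingCompl] at hy
    exact h y fun u => hy u trivial

variable {E : Type*} [NormedAddCommGroup E] [NormedSpace ℂ E] [FiniteDimensional ℂ E]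
  {G : Type*} [TopologicalSpace G] [ChartedSpace E G] [Group G] [LieGroup 𝓘(ℂ, E) ω G]

theorem exists_mem_regularElements_of_isOpen
    [LieAlgebra.IsKilling ℂ (GroupLieAlgebra 𝓘(ℂ, E) G)] {U : Set E} (hU : IsOpen U)
    (hne : U.Nonempty) :
    ∃ x : GroupLieAlgebra 𝓘(ℂ, E) G, x ∈ U ∧ x ∈ regularElements (GroupLieAlgebra 𝓘(ℂ, E) G) := by
  classical
  let b := Module.finBasis ℂ (GroupLieAlgebra 𝓘(ℂ, E) G)
  obtain ⟨x₀, hx₀⟩ := LieAlgebra.exists_isRegular ℂ (GroupLieAlgebra 𝓘(ℂ, E) G)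
  obtain ⟨x, hx, hreg⟩ := exists_eval_repr_ne_zero (L := E) b _
    ⟨x₀, (LieAlgebra.isRegular_iff_coeff_polyCharpoly_rank_ne_zero ℂ b x₀).1 hx₀⟩ hU hne
  exact ⟨x, hx, LieAlgebra.IsRegular.mem_regularElements
    ((LieAlgebra.isRegular_iff_coeff_polyCharpoly_rank_ne_zero ℂ b x).2 hreg)⟩

end LieAlgebra

section SymplecticForm

variable {F : Type*} [NormedAddCommGroup F] [NormedSpace ℂ F]
  {X : Type*} [TopologicalSpace X] [ChartedSpace F X]

/-- A symplectic form at a point, as a bilinear form. -/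
def HolomorphicSymplecticForm.bilin (Ω : HolomorphicSymplecticForm F X) (x : X) :
    LinearMap.BilinForm ℂ (TangentSpace 𝓘(ℂ, F) x) :=
  have hupdate : ∀ v u : TangentSpace 𝓘(ℂ, F) x, Function.update ![v, 0] 1 u = ![v, u] := by
    intro v u
    ext i
    fin_cases i <;> rfl
  LinearMap.mk₂ ℂ (fun v w => Ω.form x ![v, w])
    (fun v v' w => (Ω.form x).vecCons_add ![w] v v')
    (fun c v w => (Ω.form x).vecCons_smul ![w] c v)
    (fun v w w' => by
      have h := (Ω.form x).map_update_add ![v, 0] 1 w w'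
      simpa only [hupdate v] using h)
    (fun c v w => by
      have h := (Ω.form x).map_update_smul ![v, 0] 1 c w
      simpa only [hupdate v] using h)

theorem HolomorphicSymplecticForm.bilin_isAlt (Ω : HolomorphicSymplecticForm F X) (x : X) :
    (Ω.bilin x).IsAlt := fun v =>
  (Ω.form x).map_eq_zero_of_eq ![v, v] (i := 0) (j := 1) rfl (by simp)

theorem HolomorphicSymplecticForm.bilin_nondegenerate (Ω : HolomorphicSymplecticForm F X) (x : X) :
    (Ω.bilin x).Nondegenerate :=
  ⟨fun v h => Ω.nondegenerate x v h, fun v h => Ω.nondegenerate x v fun w =>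
    (Ω.bilin_isAlt x).isRefl.eq_zero (h w)⟩

end SymplecticForm

section FirstIntegrals

variable {F E : Type*} [NormedAddCommGroup F] [NormedSpace ℂ F]
  [NormedAddCommGroup E] [NormedSpace ℂ E]
  {X : Type*} [TopologicalSpace X] [ChartedSpace F X]

/-- A holomorphic function whose differential vanishes on the kernel of the differential of a
submersion is a first integral of the foliation by the components of its fibres. -/
theorem isFirstIntegralOn_of_mfderiv_eq_zero [IsManifold 𝓘(ℂ, F) ω X] {f : X → E} {π : F →L[ℂ] E}
    (hf : ContMDiff 𝓘(ℂ, F) 𝓘(ℂ, E) ω f)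
    (hcover : ∀ x, ∃ φ ∈ straighteningCharts f π, x ∈ φ.source) {U : Set X} (hU : IsOpen U)
    {g : X → ℂ} (hg : ContMDiffOn 𝓘(ℂ, F) 𝓘(ℂ, ℂ) ω g U)
    (h : ∀ x ∈ U, ∀ w : TangentSpace 𝓘(ℂ, F) x, mfderiv 𝓘(ℂ, F) 𝓘(ℂ, E) f x w = 0 →
      mfderiv 𝓘(ℂ, F) 𝓘(ℂ, ℂ) g x w = 0) :
    IsFirstIntegralOn F (fibreComponents f) U g := by
  refine ⟨hg, fun x hx y hy => ?_⟩
  have hsub := connectedComponentIn_subset ({z | fibreComponents f x z} ∩ U) x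
  refine (isPreconnected_connectedComponentIn (F := {z | fibreComponents f x z} ∩ U)
    (x := x)).induction₂ (fun a b => g b = g a) ?_ (fun a b c _ _ _ h₁ h₂ => h₂.trans h₁)
    (fun a b _ _ h₁ => h₁.symm) (mem_connectedComponentIn ⟨(fibreComponents f).refl x, hx⟩) hy
  intro a ha
  obtain ⟨φ, hφ, haφ⟩ := hcover a
  let V := LinearMap.ker π.toLinearMap
  let k : V → F := fun v => φ a + v
  have hk : ∀ v, HasFDerivAt k V.subtypeL v := fun v => V.subtypeL.hasFDerivAt.const_add _
  have hkc : Continuous k := by fun_prop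
  have hopen : IsOpen (φ.target ∩ φ.symm ⁻¹' U) := φ.isOpen_inter_preimage_symm hU
  have hk0 : k 0 ∈ φ.target ∩ φ.symm ⁻¹' U := by
    simp only [k, ZeroMemClass.coe_zero, add_zero]
    refine ⟨φ.map_source haφ, ?_⟩
    rw [Set.mem_preimage, φ.left_inv haφ]
    exact (hsub ha).2
  obtain ⟨ε, hε, hball⟩ := Metric.isOpen_iff.1 (hopen.preimage hkc) 0 hk0
  have hderiv : ∀ v ∈ Metric.ball (0 : V) ε, HasFDerivAt (fun v => g (φ.symm (k v)))
      (0 : V →L[ℂ] ℂ) v := by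
    intro v hv
    obtain ⟨hv₁, hv₂⟩ := hball hv
    have hgd : MDifferentiableAt 𝓘(ℂ, F) 𝓘(ℂ, ℂ) g (φ.symm (k v)) :=
      (hg.contMDiffAt (hU.mem_nhds hv₂)).mdifferentiableAt (by simp)
    have hφd : MDifferentiableAt 𝓘(ℂ, F) 𝓘(ℂ, F) φ.symm (k v) :=
      (contMDiffAt_symm_of_mem_maximalAtlas hφ.1 hv₁).mdifferentiableAt (by simp)
    have hfd : MDifferentiableAt 𝓘(ℂ, F) 𝓘(ℂ, E) f (φ.symm (k v)) :=
      hf.mdifferentiableAt (by simp)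
    have hφk : HasMFDerivAt 𝓘(ℂ, V) 𝓘(ℂ, F) (φ.symm ∘ k) v
        ((mfderiv 𝓘(ℂ, F) 𝓘(ℂ, F) φ.symm (k v)).comp V.subtypeL) :=
      HasMFDerivAt.comp v hφd.hasMFDerivAt (hk v).hasMFDerivAt
    have hcomp : HasMFDerivAt 𝓘(ℂ, V) 𝓘(ℂ, ℂ) (g ∘ φ.symm ∘ k) v
        ((mfderiv 𝓘(ℂ, F) 𝓘(ℂ, ℂ) g (φ.symm (k v))).comp
          ((mfderiv 𝓘(ℂ, F) 𝓘(ℂ, F) φ.symm (k v)).comp V.subtypeL)) :=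
      HasMFDerivAt.comp v hgd.hasMFDerivAt hφk
    have hcompf : HasMFDerivAt 𝓘(ℂ, V) 𝓘(ℂ, E) (f ∘ φ.symm ∘ k) v
        ((mfderiv 𝓘(ℂ, F) 𝓘(ℂ, E) f (φ.symm (k v))).comp
          ((mfderiv 𝓘(ℂ, F) 𝓘(ℂ, F) φ.symm (k v)).comp V.subtypeL)) :=
      HasMFDerivAt.comp v hfd.hasMFDerivAt hφk
    have hconst : f ∘ φ.symm ∘ k =ᶠ[𝓝 v] fun _ => π (φ a) := by
      filter_upwards [(hopen.preimage hkc).mem_nhds (hball hv)] with u hu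
      simp only [Function.comp_apply]
      rw [← hφ.2.2 _ (φ.map_target hu.1), φ.right_inv hu.1]
      simp only [k, map_add]
      rw [show π (u : F) = 0 from u.2, add_zero]
    have hzero : (mfderiv 𝓘(ℂ, F) 𝓘(ℂ, ℂ) g (φ.symm (k v))).comp
          ((mfderiv 𝓘(ℂ, F) 𝓘(ℂ, F) φ.symm (k v)).comp V.subtypeL) = (0 : V →L[ℂ] ℂ) := by
      ext u
      refine h _ hv₂ _ ?_
      have h₁ := DFunLike.congr_fun (hcompf.mfderiv.symm.trans (hconst.mfderiv_eq)) u
      refine h₁.trans ?_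
      rw [mfderiv_const]
      rfl
    exact hcomp.hasFDerivAt.congr_fderiv hzero
  have hconst : ∀ v ∈ Metric.ball (0 : V) ε, g (φ.symm (k v)) = g (φ.symm (k 0)) := by
    intro v hv
    exact Metric.isOpen_ball.is_const_of_fderiv_eq_zero (𝕜 := ℂ) Metric.isPreconnected_ball
      (fun v hv => (hderiv v hv).differentiableAt.differentiableWithinAt)
      (fun v hv => (hderiv v hv).fderiv) hv (Metric.mem_ball_self hε)
  have hnear : ∀ᶠ b in 𝓝 a, b ∈ φ.source ∧ dist (φ b) (φ a) < ε :=
    (φ.open_source.eventually_mem haφ).and ((φ.continuousAt haφ).eventually (Metric.ball_mem_nhds _ hε))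
  filter_upwards [self_mem_nhdsWithin, mem_nhdsWithin_of_mem_nhds hnear] with b hb hb'
  have hfab : f b = f a :=
    (apply_eq_of_fibreComponents (hsub hb).1).trans (apply_eq_of_fibreComponents (hsub ha).1).symm
  let v : V := ⟨φ b - φ a, (sub_mem_ker_iff_of_mem_straighteningCharts hφ haφ hb'.1).2 hfab⟩
  have hv : v ∈ Metric.ball (0 : V) ε := by
    rw [mem_ball_zero_iff]
    change ‖φ b - φ a‖ < ε
    rw [← dist_eq_norm]
    exact hb'.2
  have := hconst v hv
  simpa [k, v, φ.left_inv haφ, φ.left_inv hb'.1] using this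

end FirstIntegrals

section HamiltonianActions

variable {E : Type*} [NormedAddCommGroup E] [NormedSpace ℂ E]
  {G : Type*} [TopologicalSpace G] [ChartedSpace E G] [Group G]
  {F : Type*} [NormedAddCommGroup F] [NormedSpace ℂ F]
  {X : Type*} [TopologicalSpace X] [ChartedSpace F X]

/-- The differential of a map to the Lie algebra of `G`, with values in this Lie algebra. -/
def momentDifferential (μ : X → GroupLieAlgebra 𝓘(ℂ, E) G) (x : X) :
    TangentSpace 𝓘(ℂ, F) x →ₗ[ℂ] GroupLieAlgebra 𝓘(ℂ, E) G :=
  ContinuousLinearMap.toLinearMap (M₂ := E) (mfderiv (M' := E) 𝓘(ℂ, F) 𝓘(ℂ, E) μ x)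

variable [FiniteDimensional ℂ E] [LieGroup 𝓘(ℂ, E) ω G] [MulAction G X]
  {Ω : HolomorphicSymplecticForm F X} {μ : X → GroupLieAlgebra 𝓘(ℂ, E) G}

theorem IsHamiltonianAction.bilin_fundamentalVectorField (hμ : IsHamiltonianAction Ω μ) (x : X)
    (y : GroupLieAlgebra 𝓘(ℂ, E) G) (w : TangentSpace 𝓘(ℂ, F) x) :
    Ω.bilin x (fundamentalVectorField y x) w =
      killingForm ℂ (GroupLieAlgebra 𝓘(ℂ, E) G) (momentDifferential (F := F) μ x w) y := by
  let κ : E →L[ℂ] ℂ := LinearMap.toContinuousLinearMap (E := E)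
    ((killingForm ℂ (GroupLieAlgebra 𝓘(ℂ, E) G)).flip y)
  have hd : MDifferentiableAt (M' := E) 𝓘(ℂ, F) 𝓘(ℂ, E) μ x :=
    hμ.holomorphic.mdifferentiableAt (by simp)
  have hcomp : HasMFDerivAt 𝓘(ℂ, F) 𝓘(ℂ, ℂ) (κ ∘ μ) x
      (κ.comp (mfderiv (M' := E) 𝓘(ℂ, F) 𝓘(ℂ, E) μ x)) :=
    HasMFDerivAt.comp (M' := E) x κ.hasMFDerivAt hd.hasMFDerivAt
  exact (hμ.isHamiltonianVector y x w).trans (DFunLike.congr_fun hcomp.mfderiv w)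

theorem IsHamiltonianAction.eq_zero_of_killingForm (hμ : IsHamiltonianAction Ω μ)
    (hfree : IsLocallyFreeAction E G F X) [Nonempty X] (y : GroupLieAlgebra 𝓘(ℂ, E) G)
    (hy : ∀ u, killingForm ℂ (GroupLieAlgebra 𝓘(ℂ, E) G) u y = 0) : y = 0 := by
  obtain ⟨x⟩ := ‹Nonempty X›
  refine hfree x y (Ω.nondegenerate x _ fun w => ?_)
  exact (hμ.bilin_fundamentalVectorField x y w).trans (hy _)

theorem IsHamiltonianAction.ker_momentDifferential (hμ : IsHamiltonianAction Ω μ)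
    (hfree : IsLocallyFreeAction E G F X) (x : X) :
    LinearMap.ker (momentDifferential (F := F) μ x) =
      (Ω.bilin x).orthogonal (LinearMap.range (infinitesimalAction (F := F) E G x)) := by
  have : Nonempty X := ⟨x⟩
  ext w
  rw [LinearMap.mem_ker]
  constructor
  · rintro hw _ ⟨y, rfl⟩
    refine (hμ.bilin_fundamentalVectorField x y w).trans ?_
    rw [hw, map_zero, LinearMap.zero_apply]
  · intro hw
    refine hμ.eq_zero_of_killingForm hfree _ fun y => ?_
    rw [LieModule.traceForm_comm]
    exact (hμ.bilin_fundamentalVectorField x y w).symm.trans (hw _ ⟨y, rfl⟩)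

omit [FiniteDimensional ℂ E] [LieGroup 𝓘(ℂ, E) ω G] in
theorem IsLocallyFreeAction.injective_infinitesimalAction (hfree : IsLocallyFreeAction E G F X)
    (x : X) : Function.Injective (infinitesimalAction (F := F) E G x) :=
  (injective_iff_map_eq_zero _).2 (hfree x)

variable [FiniteDimensional ℂ F]

theorem IsHamiltonianAction.finrank_ker_momentDifferential (hμ : IsHamiltonianAction Ω μ)
    (hfree : IsLocallyFreeAction E G F X) (x : X) :
    Module.finrank ℂ (LinearMap.ker (momentDifferential (F := F) μ x)) + Module.finrank ℂ E =
      Module.finrank ℂ F := by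
  have h₁ : Module.finrank ℂ (LinearMap.range (infinitesimalAction (F := F) E G x)) =
      Module.finrank ℂ E :=
    LinearMap.finrank_range_of_inj (hfree.injective_infinitesimalAction x)
  have h₂ := Submodule.finrank_le (LinearMap.range (infinitesimalAction (F := F) E G x))
  have h₃ : Module.finrank ℂ (TangentSpace 𝓘(ℂ, F) x) = Module.finrank ℂ F := rfl
  rw [hμ.ker_momentDifferential hfree,
    LinearMap.BilinForm.finrank_orthogonal (Ω.bilin_nondegenerate x)]
  omega

theorem IsHamiltonianAction.surjective_momentDifferential (hμ : IsHamiltonianAction Ω μ)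
    (hfree : IsLocallyFreeAction E G F X) (x : X) :
    Function.Surjective (momentDifferential (F := F) μ x) := by
  have h₁ := hμ.finrank_ker_momentDifferential hfree x
  have h₂ := (momentDifferential (F := F) μ x).finrank_range_add_finrank_ker
  have h₃ : Module.finrank ℂ (TangentSpace 𝓘(ℂ, F) x) = Module.finrank ℂ F := rfl
  have h₄ : Module.finrank ℂ (GroupLieAlgebra 𝓘(ℂ, E) G) = Module.finrank ℂ E := rfl
  exact LinearMap.range_eq_top.1 (Submodule.eq_top_of_finrank_eq (by omega))

variable [ContMDiffSMul 𝓘(ℂ, E) 𝓘(ℂ, F) ω G X]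

omit [FiniteDimensional ℂ F] in
theorem IsHamiltonianAction.momentDifferential_fundamentalVectorField
    (hμ : IsHamiltonianAction Ω μ) (x : X) (y : GroupLieAlgebra 𝓘(ℂ, E) G) :
    momentDifferential (F := F) μ x (fundamentalVectorField y x) = ⁅y, μ x⁆ := by
  have hd : MDifferentiableAt (M' := E) 𝓘(ℂ, F) 𝓘(ℂ, E) μ x :=
    hμ.holomorphic.mdifferentiableAt (by simp)
  have h₁ := mfderiv_comp_orbitMap (E' := E) (G := G) hd y
  have h₂ : (fun g : G => (μ (g • x) : GroupLieAlgebra 𝓘(ℂ, E) G)) =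
      fun g => adjointAction g (μ x) := funext fun g => hμ.equivariant g x
  refine h₁.symm.trans (Eq.trans ?_ (mfderiv_adjointAction y (μ x)))
  exact congrArg (fun f : G → E => (mfderiv (M' := E) 𝓘(ℂ, E) 𝓘(ℂ, E) f 1 : E → E) y) h₂

/-- The fibre of the moment map through `x` is isotropic at `x` if and only if the centralizer of
`μ x` has the dimension of the fibre. -/
theorem IsHamiltonianAction.ker_le_range_iff (hμ : IsHamiltonianAction Ω μ)
    (hfree : IsLocallyFreeAction E G F X) (x : X) :
    LinearMap.ker (momentDifferential (F := F) μ x) ≤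
        LinearMap.range (infinitesimalAction (F := F) E G x) ↔
      Module.finrank ℂ F = Module.finrank ℂ E + Module.finrank ℂ
        (LinearMap.ker (LieAlgebra.ad ℂ (GroupLieAlgebra 𝓘(ℂ, E) G) (μ x))) := by
  have hker : LinearMap.ker (momentDifferential (F := F) μ x ∘ₗ infinitesimalAction (F := F) E G x) =
      LinearMap.ker (LieAlgebra.ad ℂ (GroupLieAlgebra 𝓘(ℂ, E) G) (μ x)) := by
    ext y
    rw [LinearMap.mem_ker, LinearMap.mem_ker, LieAlgebra.ad_apply, ← lie_skew, neg_eq_zero]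
    exact Eq.congr_left (hμ.momentDifferential_fundamentalVectorField x y)
  rw [le_range_iff_finrank_eq (hfree.injective_infinitesimalAction x), hker]
  have := hμ.finrank_ker_momentDifferential hfree x
  omega

end HamiltonianActions

section HamiltonianActions

variable {E : Type*} [NormedAddCommGroup E] [NormedSpace ℂ E] [FiniteDimensional ℂ E]
  {G : Type*} [TopologicalSpace G] [ChartedSpace E G] [Group G] [LieGroup 𝓘(ℂ, E) ω G]
  {F : Type*} [NormedAddCommGroup F] [NormedSpace ℂ F] [FiniteDimensional ℂ F]
  {X : Type*} [TopologicalSpace X] [ChartedSpace F X] [IsManifold 𝓘(ℂ, F) ω X]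
  [MulAction G X] [ContMDiffSMul 𝓘(ℂ, E) 𝓘(ℂ, F) ω G X]
  {Ω : HolomorphicSymplecticForm F X} {μ : X → GroupLieAlgebra 𝓘(ℂ, E) G}

omit [ContMDiffSMul 𝓘(ℂ, E) 𝓘(ℂ, F) ω G X] in
theorem IsHamiltonianAction.exists_straighteningCharts (hμ : IsHamiltonianAction Ω μ)
    (hfree : IsLocallyFreeAction E G F X) [Nonempty X] :
    ∃ π : F →L[ℂ] E, Function.Surjective π ∧
      ∀ x, ∃ φ ∈ straighteningCharts (E := E) μ π, x ∈ φ.source := by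
  obtain ⟨x₀⟩ := ‹Nonempty X›
  have hsurj : ∀ x, Function.Surjective (mfderiv (M' := E) 𝓘(ℂ, F) 𝓘(ℂ, E) μ x) := fun x =>
    hμ.surjective_momentDifferential hfree x
  let π : F →L[ℂ] E := mfderiv (M' := E) 𝓘(ℂ, F) 𝓘(ℂ, E) μ x₀
  have hπ : Function.Surjective π := hsurj x₀
  refine ⟨π, hπ, fun x => ?_⟩
  obtain ⟨φ, hφ, hx, hconv, hπφ⟩ :=
    exists_chart_comp_eq (E := E) (f := μ) hμ.holomorphic x (hsurj x) π hπ
  exact ⟨φ, ⟨hφ, hconv, hπφ⟩, hx⟩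

omit [ContMDiffSMul 𝓘(ℂ, E) 𝓘(ℂ, F) ω G X] in
theorem IsHamiltonianAction.leafTangentSpace_eq (hμ : IsHamiltonianAction Ω μ)
    (hfree : IsLocallyFreeAction E G F X) (x : X) :
    leafTangentSpace F (fibreComponents μ) x =
      LinearMap.ker (momentDifferential (F := F) μ x) := by
  have : Nonempty X := ⟨x⟩
  obtain ⟨π, -, hcover⟩ := hμ.exists_straighteningCharts hfree
  obtain ⟨φ, hφ, hx⟩ := hcover x
  ext w
  exact leafTangentSpace_fibreComponents (E := E) hμ.holomorphic hφ hx w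

omit [ContMDiffSMul 𝓘(ℂ, E) 𝓘(ℂ, F) ω G X] in
theorem IsHamiltonianAction.isHolomorphicFoliation (hμ : IsHamiltonianAction Ω μ)
    (hfree : IsLocallyFreeAction E G F X) [Nonempty X] :
    ∃ r, r + Module.finrank ℂ E = Module.finrank ℂ F ∧
      IsHolomorphicFoliation F (fibreComponents μ) r := by
  obtain ⟨π, hπ, hcover⟩ := hμ.exists_straighteningCharts hfree
  refine ⟨_, ?_, isHolomorphicFoliation_fibreComponents (E := E) hcover⟩
  have h := π.toLinearMap.finrank_range_add_finrank_ker
  rw [LinearMap.range_eq_top.2 hπ, finrank_top] at h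
  omega

/-- The foliation is isotropic if and only if all centralizers of values of the moment map have
the dimension of the leaves. -/
theorem IsHamiltonianAction.isIsotropicFoliation_iff (hμ : IsHamiltonianAction Ω μ)
    (hfree : IsLocallyFreeAction E G F X) [Nonempty X] :
    IsIsotropicFoliation Ω (fibreComponents μ) ↔
      ∀ x, Module.finrank ℂ F = Module.finrank ℂ E + Module.finrank ℂ
        (LinearMap.ker (LieAlgebra.ad ℂ (GroupLieAlgebra 𝓘(ℂ, E) G) (μ x))) := by
  have hpoint : ∀ x, (∀ v ∈ leafTangentSpace F (fibreComponents μ) x,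
      ∀ w ∈ leafTangentSpace F (fibreComponents μ) x, Ω.form x ![v, w] = 0) ↔
      Module.finrank ℂ F = Module.finrank ℂ E + Module.finrank ℂ
        (LinearMap.ker (LieAlgebra.ad ℂ (GroupLieAlgebra 𝓘(ℂ, E) G) (μ x))) := by
    intro x
    rw [← hμ.ker_le_range_iff hfree, hμ.leafTangentSpace_eq hfree,
      hμ.ker_momentDifferential hfree]
    exact isotropic_orthogonal_iff (Ω.bilin_nondegenerate x) (Ω.bilin_isAlt x).isRefl
  obtain ⟨r, -, hr⟩ := hμ.isHolomorphicFoliation hfree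
  exact ⟨fun h x => (hpoint x).1 (h.2 x), fun h => ⟨⟨r, hr⟩, fun x => (hpoint x).2 (h x)⟩⟩

theorem IsHamiltonianAction.isIsotropicFoliation_iff_regular (hμ : IsHamiltonianAction Ω μ)
    (hfree : IsLocallyFreeAction E G F X) [Nonempty X] :
    IsIsotropicFoliation Ω (fibreComponents μ) ↔
      Set.range μ ⊆ regularElements (GroupLieAlgebra 𝓘(ℂ, E) G) ∧
      Module.finrank ℂ F =
        Module.finrank ℂ E + LieAlgebra.rank ℂ (GroupLieAlgebra 𝓘(ℂ, E) G) := by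
  rw [hμ.isIsotropicFoliation_iff hfree]
  constructor
  · intro h
    have : LieAlgebra.IsKilling ℂ (GroupLieAlgebra 𝓘(ℂ, E) G) :=
      LieAlgebra.isKilling_of_forall_killingForm (hμ.eq_zero_of_killingForm hfree)
    have : CompleteSpace E := FiniteDimensional.complete ℂ E
    have : CompleteSpace F := FiniteDimensional.complete ℂ F
    obtain ⟨π, hπ, hcover⟩ := hμ.exists_straighteningCharts hfree
    obtain ⟨x₀⟩ := ‹Nonempty X›
    obtain ⟨φ, hφ, hx₀⟩ := hcover x₀
    obtain ⟨U, hU, hne, hsub⟩ := exists_isOpen_subset_range hφ hπ hx₀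
    obtain ⟨z, hzU, hz⟩ := exists_mem_regularElements_of_isOpen (G := G) hU hne
    obtain ⟨x, rfl⟩ := hsub hzU
    have hdim : Module.finrank ℂ F =
        Module.finrank ℂ E + LieAlgebra.rank ℂ (GroupLieAlgebra 𝓘(ℂ, E) G) := by
      rw [← hz]
      exact h x
    refine ⟨?_, hdim⟩
    rintro _ ⟨x, rfl⟩
    exact Nat.add_left_cancel ((h x).symm.trans hdim)
  · rintro ⟨hreg, hdim⟩ x
    rw [hdim, show Module.finrank ℂ (LinearMap.ker _) = _ from hreg ⟨x, rfl⟩]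

/-- The first integrals are coordinates transverse to the orbits of `G`. -/
theorem IsHamiltonianAction.exists_firstIntegrals (hμ : IsHamiltonianAction Ω μ)
    (hfree : IsLocallyFreeAction E G F X)
    (hiso : ∀ x, LinearMap.ker (momentDifferential (F := F) μ x) ≤
      LinearMap.range (infinitesimalAction (F := F) E G x)) (x₀ : X) :
    ∃ U : Set X, IsOpen U ∧ x₀ ∈ U ∧ ∃ (k : ℕ) (f : Fin k → X → ℂ),
      (∀ i, IsFirstIntegralOn F (fibreComponents μ) U (f i)) ∧
      ∀ y ∈ U, Submodule.span ℂ {v | ∃ i, Ω.IsHamiltonianVector (f i) y v} =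
        leafTangentSpace F (fibreComponents μ) y := by
  have : Nonempty X := ⟨x₀⟩
  obtain ⟨π, -, hcover⟩ := hμ.exists_straighteningCharts hfree
  obtain ⟨U, f, hU, hx₀, hf, hker⟩ := exists_map_ker_mfderiv_eq_orbit (G := G) hfree x₀
  let b := Module.finBasis ℂ F
  let ℓ : Fin (Module.finrank ℂ F) → F →L[ℂ] ℂ := fun i =>
    LinearMap.toContinuousLinearMap (b.coord i)
  have hd : ∀ i, ∀ x ∈ U, ∀ w : TangentSpace 𝓘(ℂ, F) x,
      @Eq ℂ (mfderiv 𝓘(ℂ, F) 𝓘(ℂ, ℂ) (ℓ i ∘ f) x w) (ℓ i (mfderiv 𝓘(ℂ, F) 𝓘(ℂ, F) f x w)) := by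
    intro i x hx w
    have hfd : MDifferentiableAt 𝓘(ℂ, F) 𝓘(ℂ, F) f x :=
      (hf.contMDiffAt (hU.mem_nhds hx)).mdifferentiableAt (by simp)
    have hcomp : HasMFDerivAt 𝓘(ℂ, F) 𝓘(ℂ, ℂ) (ℓ i ∘ f) x
        ((ℓ i).comp (mfderiv 𝓘(ℂ, F) 𝓘(ℂ, F) f x)) :=
      HasMFDerivAt.comp x (ℓ i).hasMFDerivAt hfd.hasMFDerivAt
    exact DFunLike.congr_fun hcomp.mfderiv w
  refine ⟨U, hU, hx₀, Module.finrank ℂ F, fun i => ℓ i ∘ f, fun i => ?_, fun x hx => ?_⟩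
  · refine isFirstIntegralOn_of_mfderiv_eq_zero (E := E) hμ.holomorphic hcover hU
      ((ℓ i).contDiff.contMDiff.comp_contMDiffOn hf) fun x hx w hw => ?_
    obtain ⟨y, rfl⟩ := hiso x hw
    refine (hd i x hx _).trans ?_
    exact (congrArg (ℓ i) ((hker x hx _).2 ⟨y, rfl⟩)).trans (map_zero (ℓ i))
  · rw [hμ.leafTangentSpace_eq hfree, hμ.ker_momentDifferential hfree]
    let α : Fin (Module.finrank ℂ F) → TangentSpace 𝓘(ℂ, F) x →ₗ[ℂ] ℂ := fun i =>
      (ℓ i).toLinearMap ∘ₗ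
        ContinuousLinearMap.toLinearMap (M₂ := F) (mfderiv 𝓘(ℂ, F) 𝓘(ℂ, F) f x)
    have hα : ⨅ i, LinearMap.ker (α i) =
        LinearMap.range (infinitesimalAction (F := F) E G x) := by
      ext w
      rw [Submodule.mem_iInf, LinearMap.mem_range]
      refine Iff.trans ?_ (hker x hx w)
      constructor
      · intro h
        exact b.ext_elem fun i => (h i).trans (by simp)
      · intro h i
        exact (congrArg (ℓ i) h).trans (map_zero (ℓ i))
    have hspan := span_eq_orthogonal_of_iInf_ker_eq (Ω.bilin_nondegenerate x)
      (Ω.bilin_isAlt x).isRefl hα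
    rw [← hspan]
    congr 1
    ext v
    refine exists_congr fun i => forall_congr' fun w => ?_
    exact Eq.congr_right (hd i x hx w)

end HamiltonianActions

end

theorem mainTheorem2
    {E : Type*} [NormedAddCommGroup E] [NormedSpace ℂ E] [FiniteDimensional ℂ E]
    {G : Type*} [TopologicalSpace G] [ChartedSpace E G] [Group G] [LieGroup 𝓘(ℂ, E) ω G]
    [SimplyConnectedSpace G] [LieAlgebra.IsSemisimple ℂ (GroupLieAlgebra 𝓘(ℂ, E) G)]
    {F : Type*} [NormedAddCommGroup F] [NormedSpace ℂ F] [FiniteDimensional ℂ F]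
    {X : Type*} [TopologicalSpace X] [T2Space X] [SecondCountableTopology X] [Nonempty X]
    [ChartedSpace F X] [IsManifold 𝓘(ℂ, F) ω X]
    [MulAction G X] [ContMDiffSMul 𝓘(ℂ, E) 𝓘(ℂ, F) ω G X]
    (Ω : HolomorphicSymplecticForm F X) (μ : X → GroupLieAlgebra 𝓘(ℂ, E) G)
    (hfree : IsLocallyFreeAction E G F X) (hμ : IsHamiltonianAction Ω μ) :
    (∃ r, r + Module.finrank ℂ E = Module.finrank ℂ F ∧
      IsHolomorphicFoliation F (fibreComponents μ) r) ∧
    (IsIsotropicFoliation Ω (fibreComponents μ) ↔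
      Set.range μ ⊆ regularElements (GroupLieAlgebra 𝓘(ℂ, E) G) ∧
      Module.finrank ℂ F =
        Module.finrank ℂ E + LieAlgebra.rank ℂ (GroupLieAlgebra 𝓘(ℂ, E) G)) ∧
    (IsIsotropicFoliation Ω (fibreComponents μ) →
      IsAbstractIntegrableSystem Ω (fibreComponents μ)
        (LieAlgebra.rank ℂ (GroupLieAlgebra 𝓘(ℂ, E) G))) := by
  have hiff := hμ.isIsotropicFoliation_iff_regular hfree
  obtain ⟨r, hr, hfol⟩ := hμ.isHolomorphicFoliation hfree
  refine ⟨⟨r, hr, hfol⟩, hiff, fun h => ⟨?_, fun x => ?_⟩⟩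
  · have hrank : r = LieAlgebra.rank ℂ (GroupLieAlgebra 𝓘(ℂ, E) G) := by
      have := (hiff.1 h).2
      omega
    rwa [← hrank]
  · exact hμ.exists_firstIntegrals hfree (fun x =>
      (hμ.ker_le_range_iff hfree x).2 ((hμ.isIsotropicFoliation_iff hfree).1 h x)) x
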